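/- **Model.** Let $n=rk$ and let $\{A_1,\dots,A_r\}$, $\{B_1,\dots,B_r\}$ be two partitions of $\{1,\dots,n\}$ into blocks of size $k$. Let $\chi_{ij}$ ($1\le i,j\le r$) be i.i.d. Bernoulli$(1/2)$ and let $\mathbf X\in\{0,1\}^{n\times n}$ be given by $\mathbf X(u,v)=\chi_{ij}$ for $(u,v)\in A_i\times B_j$. The observed matrix $\mathbf Y\in\{0,1,*\}^{n\times n}$ arises from $\mathbf X$ by flipping every entry independently with probability $p$ and then replacing every entry independently by $*$ with probability $\epsilon$. For a parameter $T$, the algorithm $\mathtt{PAF}(T)$ computes $s_{1i}=\#\{j:\mathbf Y(1,j)\ne *,\ \mathbf Y(i,j)\ne *,\ \mathbf Y(1,j)=\mathbf Y(i,j)\}$ for all rows $i$, selects $T$ rows with the highest values of $s_{1i}$ (ties are broken by any rule, possibly randomized, that depends on the values $s_{1i}$ only), and recommends, among the columns $j$ with $\mathbf Y(1,j)=*$, a column $j_{\max}$ with the maximum number of 1's in the selected rows, ties being broken uniformly at random. Let $P_e[\mathtt{PAF}(T)]=\Pr[\mathbf X(1,j_{\max})=0]$; if there is no column with $\mathbf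 Y(1,j)=*$, this is counted as an error. **Theorem.** Let $n\to\infty$ along a sequence of sizes, with cluster sizes $k=k_n$ dividing $n$, arbitrary partitions as above, $p\in[0,1/2)$ fixed, and $\epsilon=1-c/n^{\alpha}\in[0,1]$ (for all large $n$), where $c>0$ is a constant. Assume $\alpha\in(0,1/2)$ and that there is a sequence $\gamma_n\ge 0$ with $\gamma_n\to 0$ and $k\ge n^{\alpha-\gamma_n}$ (for all large $n$). a) If $k=o(n)$, then $P_e[\mathtt{PAF}(k)]\to 0$. b) If $k=\Theta(n)$, then $P_e[\mathtt{PAF}(k)\mid\text{not all entries of the first row of }\mathbf X\text{ are }0]\to 0$. For $\alpha=0$ and $c<1$, if $k\to\infty$, then $P_e[\mathtt{PAF}(k)\mid\text{not all entries of the first row of }\mathbf X\text{ are }0]\to 0$, and if moreover $k=o(n)$, then $P_e[\mathtt{PAF}(k)]\to 0$. -/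

import Mathlib

open MeasureTheory ProbabilityTheory Filter Topology Asymptotics

noncomputable section

namespace PAF

/-- A pair of partitions `A_1, …, A_r` of the users and `B_1, …, B_r` of the items, both sets
being `Fin n`, into `r` blocks that all have exactly `k` elements. A partition is given by the
map that sends a point to the label of its block. -/
structure Clustering (n r k : ℕ) where
  /-- label of the row cluster of a user -/
  row : Fin n → Fin r
  /-- label of the column cluster of an item -/
  col : Fin n → Fin r
  card_row : ∀ a : Fin r, (Finset.univ.filter fun i => row i = a).card = k
  card_col : ∀ b : Fin r, (Finset.univ.filter fun j => col j = b).card = k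

/-- The randomness of the data model: the ratings `χ` of the clusters, the indicators of the bits
flipped by the symmetric channel, and the indicators of the bits erased by the erasure channel. -/
abbrev Sample (n r : ℕ) : Type :=
  (Fin r × Fin r → Bool) × (Fin n × Fin n → Bool) × (Fin n × Fin n → Bool)

/-- The number `1/2` as an element of the unit interval. -/
def half : unitInterval := ⟨1 / 2, by norm_num, by norm_num⟩

/-- All the bits are independent; cluster ratings are Bernoulli(1/2), flips are Bernoulli(`p`),
erasures are Bernoulli(`ε`). -/
def law (n r : ℕ) (p ε : unitInterval) : Measure (Sample n r) :=
  (Measure.pi fun _ : Fin r × Fin r => bernoulliMeasure true false half).prod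
    ((Measure.pi fun _ : Fin n × Fin n => bernoulliMeasure true false p).prod
      (Measure.pi fun _ : Fin n × Fin n => bernoulliMeasure true false ε))

/-- The true rating matrix `X`, constant on clusters. -/
def X {n r k : ℕ} (C : Clustering n r k) (ω : Sample n r) (i j : Fin n) : Bool :=
  ω.1 (C.row i, C.col j)

/-- The observed matrix `Y`: every entry of `X` goes through the symmetric channel and then through
the erasure channel; `none` is an erased entry. -/
def Y {n r k : ℕ} (C : Clustering n r k) (ω : Sample n r) (i j : Fin n) : Option Bool :=
  if ω.2.2 (i, j) = true then none else some (xor (X C ω i j) (ω.2.1 (i, j)))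

/-- The similarity `s_{il}`: the number of columns in which the rows `i` and `l` are both observed
and agree. -/
def similarity {n : ℕ} (y : Fin n → Fin n → Option Bool) (i l : Fin n) : ℕ :=
  (Finset.univ.filter fun j => y i j ≠ none ∧ y l j ≠ none ∧ y i j = y l j).card

/-- `S` consists of `T` rows with the highest scores `s`. -/
def IsTop {n : ℕ} (T : ℕ) (s : Fin n → ℕ) (S : Finset (Fin n)) : Prop :=
  S.card = T ∧ ∀ i ∈ S, ∀ l, l ∉ S → s l ≤ s i

/-- A (possibly randomized) way to select `T` rows with the highest scores: for each vector of
scores, a law on the sets that consist of `T` rows with the highest scores. -/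
structure TopRule (n T : ℕ) where
  select : (Fin n → ℕ) → PMF (Finset (Fin n))
  isTop : ∀ s, ∀ S ∈ (select s).support, IsTop T s S

/-- The number of 1's in column `j` among the rows in `S`. -/
def popularity {n : ℕ} (y : Fin n → Fin n → Option Bool) (S : Finset (Fin n)) (j : Fin n) : ℕ :=
  (S.filter fun i => y i j = some true).card

/-- The columns that are unobserved for the first user and that have, among these columns, the
maximum number of 1's among the rows in `S`. -/
def mostPopular {n : ℕ} [NeZero n] (y : Fin n → Fin n → Option Bool) (S : Finset (Fin n)) :
    Finset (Fin n) :=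
  Finset.univ.filter fun j =>
    y 0 j = none ∧ ∀ l, y 0 l = none → popularity y S l ≤ popularity y S j

/-- The second step of the algorithm, given the selected rows `S`: recommend a most popular
unobserved column, ties being broken uniformly at random. The output is `none` exactly if there is
no unobserved column. -/
def recommend {n : ℕ} [NeZero n] (y : Fin n → Fin n → Option Bool) (S : Finset (Fin n)) :
    PMF (Option (Fin n)) :=
  open Classical in
  if h : (mostPopular y S).Nonempty then (PMF.uniformOfFinset (mostPopular y S) h).map some
  else PMF.pure none

/-- The algorithm `PAF(T)` for the first user: the law of the recommended column upon observing
`y`. -/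
def paf {n T : ℕ} [NeZero n] (τ : TopRule n T) (y : Fin n → Fin n → Option Bool) :
    PMF (Option (Fin n)) :=
  (τ.select (similarity y 0)).bind fun S => recommend y S

/-- The conditional probability, given the data, that `PAF(T)` fails to recommend a column `j` with
`X(1,j) = 1`. The absence of a recommendation counts as an error. -/
def errorGiven {n r k T : ℕ} [NeZero n] (C : Clustering n r k) (τ : TopRule n T)
    (ω : Sample n r) : ℝ :=
  ((paf τ (Y C ω)).toOuterMeasure {o | ∀ j ∈ o, X C ω 0 j = false}).toReal

/-- The probability of error of `PAF(T)`. -/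
def errorProb {n r k T : ℕ} [NeZero n] (C : Clustering n r k) (τ : TopRule n T)
    (p ε : unitInterval) : ℝ :=
  ∫ ω, errorGiven C τ ω ∂(law n r p ε)

/-- The event that not all entries of the first row of `X` are 0. -/
def firstRowNonzero {n r k : ℕ} [NeZero n] (C : Clustering n r k) : Set (Sample n r) :=
  {ω | ∃ j, X C ω 0 j = true}

/-- The probability of error of `PAF(T)` conditioned on the event that not all entries of the first
row of `X` are 0. -/
def condErrorProb {n r k T : ℕ} [NeZero n] (C : Clustering n r k) (τ : TopRule n T)
    (p ε : unitInterval) : ℝ :=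
  ∫ ω, errorGiven C τ ω ∂((law n r p ε)[|firstRowNonzero C])

end PAF

end

/-! Write q = 1 - ε and condition on the cluster ratings χ, so that the entries of Y become
independent. The error on the event that the first row is not zero (`nonzeroError`) tends to 0 for
the following reasons.

Up to small probability, every row of X equals the first one or differs from it in at least δn
columns (`exists_Pr_separated_compl_le`). The mean similarities of these two kinds of rows are then
separated by a gap of order n q², and n q² ≥ n^β, so Chernoff bounds and a union bound over rows
show that all selected rows have the ratings of the first one (`Pr_exists_isTop_le`).

The similarities with the first row only read columns that this row observes, so the selection is
independent of the other entries in its unobserved columns (`Ex_errorOf_le`). For a fixed set of m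
agreeing rows, the popularities of those columns are independent binomials, with parameter q(1-p)
for rating 1 and qp for rating 0.

No concentration is available here, since mq may be small. Instead, exchange a 0-column with a
1-column over which it leads by D: this changes the likelihood by a factor of at most (p/(1-p))^D
(`Ex_topWeight_swap`). So a winning 0-column is unlikely to lead a given 1-column by D. On the other
hand, a typical 1-column is below a quantile t, while some of the order n many 1-columns reaches t +
D, because the binomial tail falls from t to t + D only by a polynomial factor in min(mq(1-p), 1)
(`exists_binomTail_gap`). Since kq exceeds every n^(-a), that factor loses to n.

A zero first row has probability 2^(-r) ≤ 1/2: conditioning costs a factor of at most 2, and without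
conditioning the extra term vanishes as r = n/k → ∞. -/

namespace PAF

/-! ### Finite product probability spaces as weighted sums. -/

section ProductWeights

variable {ι κ β γ : Type*} [Fintype ι] [DecidableEq ι] [Fintype κ] [DecidableEq κ] [Fintype β]
  [Fintype γ]

/-- A family of probability weights on a finite type. -/
structure IsWeight (w : ι → β → ℝ) : Prop where
  nonneg : ∀ i b, 0 ≤ w i b
  sum_eq_one : ∀ i, ∑ b, w i b = 1

/-- The expectation of `f` under the product of the weights `w i`. -/
noncomputable def Ex (w : ι → β → ℝ) (f : (ι → β) → ℝ) : ℝ :=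
  ∑ x, (∏ i, w i (x i)) * f x

/-- The probability of an event under the product of the weights `w i`. -/
noncomputable def Pr (w : ι → β → ℝ) (E : Set (ι → β)) : ℝ :=
  Ex w (E.indicator 1)

/-- Distributivity of products over sums is the source of independence here: more general functions
are reduced to this case by `sum_mul_prod_ite`. -/
theorem Ex_prod (w g : ι → β → ℝ) :
    Ex w (fun x => ∏ i, g i (x i)) = ∏ i, ∑ b, w i b * g i b := by
  rw [Fintype.prod_sum]
  simp only [Ex, Finset.prod_mul_distrib]

theorem Ex_mul_left (w : ι → β → ℝ) (a : ℝ) (f : (ι → β) → ℝ) :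
    Ex w (fun x => a * f x) = a * Ex w f := by
  simp only [Ex, Finset.mul_sum]
  exact Finset.sum_congr rfl fun x _ => by ring

theorem Ex_mul_right (w : ι → β → ℝ) (a : ℝ) (f : (ι → β) → ℝ) :
    Ex w (fun x => f x * a) = Ex w f * a := by
  simp only [Ex, Finset.sum_mul]
  exact Finset.sum_congr rfl fun x _ => by ring

theorem Ex_add (w : ι → β → ℝ) (f g : (ι → β) → ℝ) :
    Ex w (fun x => f x + g x) = Ex w f + Ex w g := by
  simp only [Ex, mul_add, Finset.sum_add_distrib]

theorem Ex_sum {σ : Type*} (s : Finset σ) (w : ι → β → ℝ) (f : σ → (ι → β) → ℝ) :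
    Ex w (fun x => ∑ a ∈ s, f a x) = ∑ a ∈ s, Ex w (f a) := by
  simp only [Ex, Finset.mul_sum]
  exact Finset.sum_comm

theorem Ex_const {w : ι → β → ℝ} (hw : IsWeight w) (a : ℝ) : Ex w (fun _ => a) = a := by
  have h := Ex_prod w (fun _ _ => 1)
  simp only [Finset.prod_const_one, mul_one, hw.sum_eq_one] at h
  simpa [h] using Ex_mul_right w a (fun _ => 1)

theorem Ex_mono {w : ι → β → ℝ} (hw : IsWeight w) {f g : (ι → β) → ℝ} (h : ∀ x, f x ≤ g x) :
    Ex w f ≤ Ex w g :=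
  Finset.sum_le_sum fun x _ =>
    mul_le_mul_of_nonneg_left (h x) (Finset.prod_nonneg fun i _ => hw.nonneg i _)

theorem Ex_nonneg {w : ι → β → ℝ} (hw : IsWeight w) {f : (ι → β) → ℝ} (h : ∀ x, 0 ≤ f x) :
    0 ≤ Ex w f :=
  Finset.sum_nonneg fun x _ => mul_nonneg (Finset.prod_nonneg fun i _ => hw.nonneg i _) (h x)

theorem Ex_le_of_le {w : ι → β → ℝ} (hw : IsWeight w) {f : (ι → β) → ℝ} {a : ℝ}
    (h : ∀ x, f x ≤ a) : Ex w f ≤ a :=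
  (Ex_mono hw h).trans_eq (Ex_const hw a)

theorem Pr_mono {w : ι → β → ℝ} (hw : IsWeight w) {E F : Set (ι → β)} (h : E ⊆ F) :
    Pr w E ≤ Pr w F :=
  Ex_mono hw fun x => Set.indicator_le_indicator_of_subset h (by simp) x

theorem Pr_iUnion_le {σ : Type*} [Fintype σ] {w : ι → β → ℝ} (hw : IsWeight w)
    (E : σ → Set (ι → β)) : Pr w (⋃ a, E a) ≤ ∑ a, Pr w (E a) := by
  unfold Pr
  rw [← Ex_sum]
  refine Ex_mono hw fun x => ?_
  have h0 : ∀ a, 0 ≤ (E a).indicator (1 : (ι → β) → ℝ) x :=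
    fun a => Set.indicator_nonneg (by simp) _
  by_cases hx : x ∈ ⋃ a, E a
  · obtain ⟨a, ha⟩ := Set.mem_iUnion.1 hx
    rw [Set.indicator_of_mem hx, ← Set.indicator_of_mem ha (1 : (ι → β) → ℝ)]
    exact Finset.single_le_sum (f := fun a => (E a).indicator (1 : (ι → β) → ℝ) x)
      (fun a _ => h0 a) (Finset.mem_univ a)
  · rw [Set.indicator_of_notMem hx]
    exact Finset.sum_nonneg fun a _ => h0 a

theorem Pr_union_le {w : ι → β → ℝ} (hw : IsWeight w) (E F : Set (ι → β)) :
    Pr w (E ∪ F) ≤ Pr w E + Pr w F := by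
  unfold Pr
  rw [← Ex_add]
  refine Ex_mono hw fun x => ?_
  by_cases hE : x ∈ E <;> by_cases hF : x ∈ F <;> simp [hE, hF]

/-- Markov's inequality. -/
theorem Pr_le_Ex {w : ι → β → ℝ} (hw : IsWeight w) {E : Set (ι → β)} {f : (ι → β) → ℝ}
    (h0 : ∀ x, 0 ≤ f x) (h1 : ∀ x ∈ E, 1 ≤ f x) : Pr w E ≤ Ex w f :=
  Ex_mono hw fun x => Set.indicator_le' (f := 1) (g := f) (s := E) h1 (fun x _ => h0 x) x

/-- Every function is a combination of products of functions of the coordinates. -/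
theorem sum_mul_prod_ite [DecidableEq β] (f : (ι → β) → ℝ) (x : ι → β) :
    f x = ∑ z, f z * ∏ i, if x i = z i then (1 : ℝ) else 0 := by
  have h : ∀ z : ι → β, (∏ i, if x i = z i then (1 : ℝ) else 0) = if x = z then 1 else 0 := by
    intro z
    rw [Finset.prod_ite_zero]
    simp [funext_iff]
  simp [h]

/-- Resampling: the coordinates in `A` come from `w`, the others from `w'`. -/
theorem Ex_piecewise {w w' : ι → β → ℝ} (hw : IsWeight w) (hw' : IsWeight w')
    (A : Set ι) [∀ i, Decidable (i ∈ A)] (f : (ι → β) → ℝ) :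
    Ex w (fun x => Ex w' fun x' => f (A.piecewise x x')) = Ex (A.piecewise w w') f := by
  classical
  have key : ∀ z : ι → β, Ex w (fun x => Ex w' fun x' =>
      ∏ i, if (A.piecewise x x') i = z i then (1 : ℝ) else 0) =
      Ex (A.piecewise w w') (fun x => ∏ i, if x i = z i then (1 : ℝ) else 0) := by
    intro z
    have h1 : ∀ x x' : ι → β, (∏ i, if (A.piecewise x x') i = z i then (1 : ℝ) else 0) =
        (∏ i, if i ∈ A then (if x i = z i then (1 : ℝ) else 0) else 1) *
          ∏ i, if i ∈ A then 1 else (if x' i = z i then (1 : ℝ) else 0) := by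
      intro x x'
      rw [← Finset.prod_mul_distrib]
      refine Finset.prod_congr rfl fun i _ => ?_
      by_cases hi : i ∈ A <;> simp [hi]
    simp only [h1, Ex_mul_left, Ex_mul_right]
    rw [Ex_prod w (fun i b => if i ∈ A then (if b = z i then (1 : ℝ) else 0) else 1),
      Ex_prod w' (fun i b => if i ∈ A then 1 else (if b = z i then (1 : ℝ) else 0)),
      Ex_prod _ (fun i b => (if b = z i then (1 : ℝ) else 0)), ← Finset.prod_mul_distrib]
    refine Finset.prod_congr rfl fun i _ => ?_
    by_cases hi : i ∈ A <;> simp [hi, hw.sum_eq_one, hw'.sum_eq_one]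
  have e : f = fun x => ∑ z, f z * ∏ i, if x i = z i then (1 : ℝ) else 0 :=
    funext fun x => sum_mul_prod_ite f x
  rw [e]
  simp only [Ex_sum, Ex_mul_left, key]

/-- The image of the product of the weights `w i` under a map that acts on each coordinate. -/
theorem Ex_map [DecidableEq γ] (w : ι → β → ℝ) (φ : ι → β → γ) (f : (ι → γ) → ℝ) :
    Ex w (fun x => f fun i => φ i (x i)) =
      Ex (fun i c => ∑ b, if φ i b = c then w i b else 0) f := by
  classical
  have e : f = fun x => ∑ z, f z * ∏ i, if x i = z i then (1 : ℝ) else 0 :=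
    funext fun x => sum_mul_prod_ite f x
  rw [e]
  simp only [Ex_sum, Ex_mul_left]
  refine Finset.sum_congr rfl fun z _ => congrArg _ ?_
  rw [Ex_prod w (fun i b => if φ i b = z i then (1 : ℝ) else 0),
    Ex_prod _ (fun i c => if c = z i then (1 : ℝ) else 0)]
  refine Finset.prod_congr rfl fun i _ => ?_
  simp

/-- The expectation of a function of the coordinates in `A` depends on the weights in `A` only. -/
theorem Ex_congr_weight {w w' : ι → β → ℝ} (hw : IsWeight w) (hw' : IsWeight w') {A : Set ι}
    (h : ∀ i ∈ A, w i = w' i) {f : (ι → β) → ℝ} (hf : DependsOn f A) : Ex w f = Ex w' f := by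
  classical
  have e : A.piecewise w w' = w' := by
    funext i
    by_cases hi : i ∈ A <;> simp [hi, h]
  have := Ex_piecewise hw hw' A f
  rw [e] at this
  rw [← this]
  refine congrArg _ (funext fun x => ?_)
  rw [← Ex_const hw' (f x)]
  refine congrArg _ (funext fun x' => hf fun i hi => ?_)
  simp [hi]

/-- Functions of disjoint sets of coordinates are uncorrelated. -/
theorem Ex_mul_of_dependsOn {w : ι → β → ℝ} (hw : IsWeight w) {A : Set ι}
    {f g : (ι → β) → ℝ} (hf : DependsOn f A) (hg : DependsOn g Aᶜ) :
    Ex w (fun x => f x * g x) = Ex w f * Ex w g := by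
  classical
  have := Ex_piecewise hw hw A (fun x => f x * g x)
  rw [Set.piecewise_same] at this
  rw [← this, ← Ex_mul_right]
  refine congrArg _ (funext fun x => ?_)
  rw [← Ex_mul_left]
  refine congrArg _ (funext fun x' => ?_)
  rw [hf (y := x) fun i hi => by simp [hi], hg (y := x') fun i hi => by
    rw [Set.piecewise_eq_of_notMem _ _ _ hi]]

/-- Columns of a matrix of independent entries are independent. -/
theorem Ex_curry (w : ι × κ → β → ℝ) (f : (ι × κ → β) → ℝ) :
    Ex w f = Ex (fun (j : κ) (b : ι → β) => ∏ i, w (i, j) (b i))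
      (fun y => f fun c => y c.2 c.1) := by
  unfold Ex
  refine Fintype.sum_equiv ((Equiv.arrowCongr (Equiv.prodComm ι κ) (Equiv.refl β)).trans
    (Equiv.curry κ ι β)) _ _ fun x => ?_
  rw [Fintype.prod_prod_type, Finset.prod_comm]
  rfl

theorem Ex_coord {w : ι → β → ℝ} (hw : IsWeight w) (i : ι) (g : β → ℝ) :
    Ex w (fun x => g (x i)) = ∑ b, w i b * g b := by
  have h : ∀ x : ι → β, g (x i) = ∏ l, if l = i then g (x l) else 1 := fun x => by simp
  simp only [h]
  rw [Ex_prod w (fun l b => if l = i then g b else 1), Finset.prod_eq_single i]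
  · simp
  · intro l _ hl
    simp [hl, hw.sum_eq_one]
  · simp

/-- The expectation of a product over the entries of a row. -/
theorem Ex_prod_row {w : ι × κ → β → ℝ} (hw : IsWeight w) (l : ι) (g : κ → β → ℝ) :
    Ex w (fun x => ∏ j, g j (x (l, j))) = ∏ j, ∑ b, w (l, j) b * g j b := by
  have h1 : ∀ x : ι × κ → β, ∏ j, g j (x (l, j)) =
      ∏ c : ι × κ, if c.1 = l then g c.2 (x c) else 1 := by
    intro x
    rw [Fintype.prod_prod_type, Finset.prod_comm]
    refine Finset.prod_congr rfl fun j _ => ?_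
    simp
  simp only [h1]
  rw [Ex_prod w (fun c b => if c.1 = l then g c.2 b else 1), Fintype.prod_prod_type,
    Finset.prod_comm]
  refine Finset.prod_congr rfl fun j _ => ?_
  rw [Finset.prod_eq_single l]
  · simp
  · intro i _ hi
    simp [hi, hw.sum_eq_one]
  · simp

/-- The expectation of a product over the columns of a function of the entries of two rows. -/
theorem Ex_prod_two_rows {w : ι × κ → β → ℝ} (hw : IsWeight w) {i l : ι} (hil : i ≠ l)
    (h : κ → β → β → ℝ) :
    Ex w (fun x => ∏ j, h j (x (i, j)) (x (l, j))) =
      ∏ j, ∑ b, ∑ b', w (i, j) b * w (l, j) b' * h j b b' := by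
  classical
  -- Row `i` is kept and all other rows are resampled, which turns the two-row product into two
  -- nested single-row expectations.
  have := Ex_piecewise hw hw {c : ι × κ | c.1 = i} (fun x => ∏ j, h j (x (i, j)) (x (l, j)))
  rw [Set.piecewise_same] at this
  rw [← this]
  have e : ∀ x x' : ι × κ → β, ∏ j, h j (Set.piecewise {c : ι × κ | c.1 = i} x x' (i, j))
      (Set.piecewise {c : ι × κ | c.1 = i} x x' (l, j)) = ∏ j, h j (x (i, j)) (x' (l, j)) := by
    intro x x'
    simp [Set.piecewise, hil.symm]
  simp only [e]
  have e2 : ∀ x : ι × κ → β, Ex w (fun x' => ∏ j, h j (x (i, j)) (x' (l, j))) =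
      ∏ j, ∑ b', w (l, j) b' * h j (x (i, j)) b' :=
    fun x => Ex_prod_row hw l fun j b' => h j (x (i, j)) b'
  simp only [e2]
  rw [Ex_prod_row hw i fun j b => ∑ b', w (l, j) b' * h j b b']
  simp only [Finset.mul_sum, mul_assoc]

end ProductWeights

/-! ### The exchange argument for the most popular column. -/

section Columns

variable {κ β : Type*} [Fintype κ] [DecidableEq κ]

/-- The columns in `U` at which the statistic `W` is maximal. -/
def topCols (U : Finset κ) (W : β → ℕ) (y : κ → β) : Finset κ :=
  U.filter fun j => ∀ l ∈ U, W (y l) ≤ W (y j)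

/-- The probability that `j` is chosen uniformly at random among the top columns. -/
noncomputable def topWeight (U : Finset κ) (W : β → ℕ) (j : κ) (y : κ → β) : ℝ :=
  if j ∈ topCols U W y then ((topCols U W y).card : ℝ)⁻¹ else 0

/-- The proportion of the top columns with label `false`. -/
noncomputable def falseFraction (x : κ → Bool) (U : Finset κ) (W : β → ℕ) (y : κ → β) : ℝ :=
  ((topCols U W y).filter fun j => x j = false).card / (topCols U W y).card

theorem topWeight_nonneg (U : Finset κ) (W : β → ℕ) (j : κ) (y : κ → β) :
    0 ≤ topWeight U W j y := by
  unfold topWeight; split_ifs <;> positivity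

theorem sum_topWeight_le (U A : Finset κ) (W : β → ℕ) (y : κ → β) :
    ∑ j ∈ A, topWeight U W j y ≤ 1 := by
  unfold topWeight
  rw [← Finset.sum_filter, Finset.sum_const, nsmul_eq_mul, ← div_eq_mul_inv]
  apply div_le_one_of_le₀ _ (by positivity)
  exact_mod_cast Finset.card_le_card fun j hj => (Finset.mem_filter.1 hj).2

theorem falseFraction_eq (x : κ → Bool) (U : Finset κ) (W : β → ℕ) (y : κ → β) :
    falseFraction x U W y = ∑ j ∈ U.filter (fun j => x j = false), topWeight U W j y := by
  unfold topWeight falseFraction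
  rw [← Finset.sum_filter, Finset.sum_const, nsmul_eq_mul, ← div_eq_mul_inv]
  congr 3
  ext j
  simp only [topCols, Finset.mem_filter]
  tauto

/-- Uniform tie-breaking makes the winning probability equivariant under permutations of the
columns, which is what the exchange argument needs. -/
theorem topWeight_comp (U : Finset κ) (W : β → ℕ) (σ : Equiv.Perm κ) (hσ : ∀ l, σ l ∈ U ↔ l ∈ U)
    (j : κ) (y : κ → β) :
    topWeight U W j (fun c => y (σ c)) = topWeight U W (σ j) y := by
  have h : ∀ j, j ∈ topCols U W (fun c => y (σ c)) ↔ σ j ∈ topCols U W y := by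
    intro j
    simp only [topCols, Finset.mem_filter, hσ]
    refine and_congr_right fun _ => ⟨fun h l hl => ?_, fun h l hl => h _ ((hσ l).2 hl)⟩
    have := h (σ.symm l) ((hσ _).1 (by simpa using hl))
    simpa using this
  unfold topWeight
  rw [Finset.card_equiv σ h]
  simp only [h]

theorem prod_eq_mul_mul_prod_erase {i j : κ} (hij : i ≠ j) (F : κ → ℝ) :
    ∏ c, F c = F i * (F j * ∏ c ∈ (Finset.univ.erase i).erase j, F c) := by
  rw [Finset.mul_prod_erase _ _ (by simp [hij.symm]), Finset.mul_prod_erase _ _ (by simp)]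

variable [Fintype β] {x : κ → Bool} {μ : Bool → β → ℝ} {U : Finset κ} {W : β → ℕ} {D : ℕ} {θ : ℝ}

/-- Exchanging the columns `i` and `j`: a column with label `false` that leads by `D` is less likely
to win than the column with label `true`. -/
theorem Ex_topWeight_swap (hμ : ∀ a b, 0 ≤ μ a b) (hθ0 : 0 ≤ θ)
    (hθ : ∀ b b', W b' + D ≤ W b → μ false b * μ true b' ≤ θ * (μ true b * μ false b'))
    {i j : κ} (hi : i ∈ U) (hj : j ∈ U) (hxi : x i = true) (hxj : x j = false) :
    Ex (fun c => μ (x c)) (fun y => if W (y i) + D ≤ W (y j) then topWeight U W j y else 0) ≤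
      θ * Ex (fun c => μ (x c)) (topWeight U W i) := by
  have hij : i ≠ j := fun h => by simp [h, hxj] at hxi
  set σ := Equiv.swap i j with hσ
  have hU : ∀ l, σ l ∈ U ↔ l ∈ U := by
    intro l
    rw [hσ, Equiv.swap_apply_def]
    split_ifs with h1 h2 <;> simp_all
  -- Relabelling by the transposition expresses the chance of `i` through the winning weight of `j`,
  -- with the laws of the two columns exchanged.
  have e : Ex (fun c => μ (x c)) (topWeight U W i) =
      ∑ y : κ → β, (∏ c, μ (x c) (y (σ c))) * topWeight U W j y := by
    unfold Ex
    refine Fintype.sum_equiv (Equiv.arrowCongr σ (Equiv.refl β)) _ _ fun y => ?_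
    have h1 : ∀ c, (Equiv.arrowCongr σ (Equiv.refl β)) y (σ c) = y c := fun c => by simp
    have h2 : (Equiv.arrowCongr σ (Equiv.refl β)) y = fun c => y (σ c) := by
      funext c
      simp [hσ, Equiv.arrowCongr]
    simp only [h1]
    rw [h2, topWeight_comp U W σ hU, hσ, Equiv.swap_apply_right]
  rw [e, Finset.mul_sum]
  refine Finset.sum_le_sum fun y _ => ?_
  have hp : ∀ z : κ → β, 0 ≤ ∏ c, μ (x c) (z c) := fun z => Finset.prod_nonneg fun c _ => hμ _ _
  have hrest : ∀ c ∈ (Finset.univ.erase i).erase j, μ (x c) (y (σ c)) = μ (x c) (y c) := by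
    intro c hc
    simp only [Finset.mem_erase] at hc
    rw [hσ, Equiv.swap_apply_of_ne_of_ne hc.2.1 hc.1]
  have hr : 0 ≤ ∏ c ∈ (Finset.univ.erase i).erase j, μ (x c) (y c) :=
    Finset.prod_nonneg fun c _ => hμ _ _
  have key : W (y i) + D ≤ W (y j) →
      ∏ c, μ (x c) (y c) ≤ θ * ∏ c, μ (x c) (y (σ c)) := by
    intro h
    rw [prod_eq_mul_mul_prod_erase hij, prod_eq_mul_mul_prod_erase hij (fun c => μ (x c) (y (σ c))),
      Finset.prod_congr rfl hrest, hσ, Equiv.swap_apply_left, Equiv.swap_apply_right, hxi, hxj]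
    have := mul_le_mul_of_nonneg_right (hθ _ _ h) hr
    calc _ = μ false (y j) * μ true (y i) * _ := by ring
      _ ≤ _ := this
      _ = _ := by ring
  beta_reduce
  split_ifs with h
  · calc _ ≤ (θ * ∏ c, μ (x c) (y (σ c))) * topWeight U W j y :=
          mul_le_mul_of_nonneg_right (key h) (topWeight_nonneg _ _ _ _)
      _ = _ := by ring
  · rw [mul_zero]
    exact mul_nonneg hθ0 (mul_nonneg (hp fun c => y (σ c)) (topWeight_nonneg _ _ _ _))

/-- If the columns with label `true` typically have a large gap between their maximum and the
level `t`, the top columns mostly have label `true`. -/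
theorem card_mul_Ex_falseFraction_le (hμ : ∀ a, (∀ b, 0 ≤ μ a b) ∧ ∑ b, μ a b = 1) (hθ0 : 0 ≤ θ)
    (hθ : ∀ b b', W b' + D ≤ W b → μ false b * μ true b' ≤ θ * (μ true b * μ false b'))
    (x : κ → Bool) (U : Finset κ) (t : ℕ) :
    ((U.filter fun j => x j = true).card : ℝ) * Ex (fun c => μ (x c)) (falseFraction x U W) ≤
      (U.filter fun j => x j = false).card * θ + (U.filter fun j => x j = true).card *
        ((∑ b, if t ≤ W b then μ true b else 0) +
          (∑ b, if t + D ≤ W b then 0 else μ true b) ^ (U.filter fun j => x j = true).card) := by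
  classical
  set w : κ → β → ℝ := fun c => μ (x c) with hwdef
  have hw : IsWeight w := ⟨fun c b => (hμ _).1 b, fun c => (hμ _).2⟩
  set Z := U.filter fun j => x j = false with hZ
  set O := U.filter fun j => x j = true with hO
  -- For each `i` in `O`: if some column leads `i` by `D`, then every top column does, so the first
  -- sum counts all `false` winners; otherwise the indicator bounds the fraction by 1.
  have hpt : ∀ y : κ → β, (O.card : ℝ) * falseFraction x U W y ≤
      (∑ j ∈ Z, ∑ i ∈ O, if W (y i) + D ≤ W (y j) then topWeight U W j y else 0) +
      ∑ i ∈ O, ({y : κ → β | ∀ l ∈ U, W (y l) < W (y i) + D}.indicator 1 y : ℝ) := by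
    intro y
    have h1 : ∀ i ∈ O, falseFraction x U W y ≤
        (∑ j ∈ Z, if W (y i) + D ≤ W (y j) then topWeight U W j y else 0) +
        ({y : κ → β | ∀ l ∈ U, W (y l) < W (y i) + D}.indicator 1 y : ℝ) := by
      intro i _
      by_cases hy : ∀ l ∈ U, W (y l) < W (y i) + D
      · rw [Set.indicator_of_mem (by exact hy), falseFraction_eq]
        have h2 := sum_topWeight_le U Z W y
        have h3 : 0 ≤ ∑ j ∈ Z, if W (y i) + D ≤ W (y j) then topWeight U W j y else 0 :=
          Finset.sum_nonneg fun j _ => by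
            split_ifs
            exacts [topWeight_nonneg _ _ _ _, le_rfl]
        simp only [Pi.one_apply]
        linarith
      · rw [Set.indicator_of_notMem (by exact hy), add_zero, falseFraction_eq]
        refine Finset.sum_le_sum fun j _ => ?_
        split_ifs with h
        · exact le_rfl
        · unfold topWeight
          rw [if_neg]
          intro hj
          push Not at hy
          obtain ⟨l, hl, hl'⟩ := hy
          have := (Finset.mem_filter.1 hj).2 l hl
          omega
    rw [Finset.sum_comm, ← Finset.sum_add_distrib, ← nsmul_eq_mul, ← Finset.sum_const]
    exact Finset.sum_le_sum h1
  rw [← Ex_mul_left]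
  refine (Ex_mono hw hpt).trans ?_
  simp only [Ex_add, Ex_sum]
  refine add_le_add ?_ ?_
  -- The winning weights of the columns in `O` sum to at most 1, so each `j` costs θ in total and
  -- not θ for each `i`.
  · have h1 : ∀ j ∈ Z, (∑ i ∈ O, Ex w (fun y =>
        if W (y i) + D ≤ W (y j) then topWeight U W j y else 0)) ≤ θ := by
      intro j hj
      calc _ ≤ ∑ i ∈ O, θ * Ex w (topWeight U W i) := by
            refine Finset.sum_le_sum fun i hi => ?_
            exact Ex_topWeight_swap (fun a => (hμ a).1) hθ0 hθ (Finset.mem_filter.1 hi).1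
              (Finset.mem_filter.1 hj).1 (Finset.mem_filter.1 hi).2 (Finset.mem_filter.1 hj).2
        _ = θ * Ex w (fun y => ∑ i ∈ O, topWeight U W i y) := by
            rw [Ex_sum, Finset.mul_sum]
        _ ≤ θ * 1 :=
            mul_le_mul_of_nonneg_left (Ex_le_of_le hw fun y => sum_topWeight_le _ _ _ _) hθ0
        _ = θ := mul_one θ
    refine (Finset.sum_le_sum h1).trans ?_
    rw [Finset.sum_const, nsmul_eq_mul]
  · rw [← nsmul_eq_mul, ← Finset.sum_const]
    refine Finset.sum_le_sum fun i hi => ?_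
    -- If no column leads `i` by `D` and `i` is below `t`, then no column of `O` reaches `t + D`;
    -- this is an event of independent columns.
    have hsub : {y : κ → β | ∀ l ∈ U, W (y l) < W (y i) + D} ⊆
        {y | t ≤ W (y i)} ∪ {y | ∀ l ∈ O, ¬ t + D ≤ W (y l)} := by
      intro y hy
      by_cases h : t ≤ W (y i)
      · exact Or.inl h
      · refine Or.inr fun l hl => ?_
        have := hy l (Finset.mem_filter.1 hl).1
        omega
    refine (Pr_mono hw hsub).trans ((Pr_union_le hw _ _).trans (add_le_add (le_of_eq ?_)
      (le_of_eq ?_)))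
    · have := Ex_coord hw i (fun b => if t ≤ W b then (1 : ℝ) else 0)
      simp only [hwdef, (Finset.mem_filter.1 hi).2, mul_ite, mul_one, mul_zero] at this
      rw [← this]
      unfold Pr
      refine congrArg _ (funext fun y => ?_)
      simp [Set.indicator_apply]
    · have := Ex_prod w (fun l b => if l ∈ O then (if t + D ≤ W b then (0 : ℝ) else 1) else 1)
      have h2 : ∀ l, (∑ b, w l b * if l ∈ O then (if t + D ≤ W b then (0 : ℝ) else 1) else 1) =
          if l ∈ O then ∑ b, (if t + D ≤ W b then 0 else μ true b) else 1 := by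
        intro l
        by_cases hl : l ∈ O
        · simp [hl, hwdef, (Finset.mem_filter.1 hl).2]
        · simp [hl, hw.sum_eq_one]
      simp only [h2] at this
      rw [Finset.prod_ite_mem, Finset.univ_inter, Finset.prod_const] at this
      rw [← this]
      unfold Pr
      refine congrArg _ (funext fun y => ?_)
      rw [Finset.prod_ite_mem, Finset.univ_inter]
      by_cases hy : ∀ l ∈ O, ¬ t + D ≤ W (y l)
      · rw [Set.indicator_of_mem (by exact hy), Finset.prod_congr rfl fun l hl => if_neg (hy l hl)]
        simp
      · rw [Set.indicator_of_notMem (by exact hy)]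
        push Not at hy
        obtain ⟨l, hl, hl'⟩ := hy
        exact (Finset.prod_eq_zero hl (by simp [hl'])).symm

end Columns

/-! ### Slow decay of the binomial tail beyond a quantile. -/

section Binomial

/-- The weights of the binomial distribution. -/
def binom (m : ℕ) (s : ℝ) (w : ℕ) : ℝ :=
  m.choose w * s ^ w * (1 - s) ^ (m - w)

/-- The upper tail of the binomial distribution. -/
def binomTail (m : ℕ) (s : ℝ) (t : ℕ) : ℝ :=
  ∑ w ∈ Finset.range (m + 1), if t ≤ w then binom m s w else 0

theorem binom_nonneg {s : ℝ} (h0 : 0 ≤ s) (h1 : s ≤ 1) (m w : ℕ) : 0 ≤ binom m s w :=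
  mul_nonneg (mul_nonneg (Nat.cast_nonneg _) (pow_nonneg h0 _)) (pow_nonneg (sub_nonneg.2 h1) _)

theorem sum_binom (m : ℕ) (s : ℝ) : ∑ w ∈ Finset.range (m + 1), binom m s w = 1 := by
  have := add_pow s (1 - s) m
  rw [add_sub_cancel, one_pow] at this
  rw [this]
  exact Finset.sum_congr rfl fun w _ => by unfold binom; ring

theorem binomTail_zero (m : ℕ) (s : ℝ) : binomTail m s 0 = 1 := by
  simp [binomTail, sum_binom]

/-- The binomial variance, read off from the variance identity of the Bernstein polynomials. -/
theorem sum_sq_mul_binom (m : ℕ) (s : ℝ) :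
    ∑ w ∈ Finset.range (m + 1), (m * s - w) ^ 2 * binom m s w = m * s * (1 - s) := by
  have := congrArg (Polynomial.eval s) (bernsteinPolynomial.variance ℝ m)
  simpa [Polynomial.eval_finsetSum, bernsteinPolynomial, binom] using this

/-- Chebyshev's inequality for the upper tail. -/
theorem sum_binom_ge_le {s : ℝ} (h0 : 0 < s) (h1 : s ≤ 1) {m : ℕ} (hm : 0 < m) {A : ℝ}
    (hA : 0 < A) :
    (∑ w ∈ Finset.range (m + 1), if m * s + A * √(m * s) ≤ w then binom m s w else 0) ≤
      1 / A ^ 2 := by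
  have hl : 0 < m * s := by positivity
  rw [le_div_iff₀ (by positivity)]
  have h : (∑ w ∈ Finset.range (m + 1), if m * s + A * √(m * s) ≤ w then binom m s w else 0) *
      (A ^ 2 * (m * s)) ≤ m * s * (1 - s) := by
    rw [← sum_sq_mul_binom, Finset.sum_mul]
    refine Finset.sum_le_sum fun w _ => ?_
    have hb := binom_nonneg h0.le h1 m w
    split_ifs with hw
    · rw [mul_comm]
      refine mul_le_mul_of_nonneg_right ?_ hb
      have h2 : A ^ 2 * (m * s) = (A * √(m * s)) ^ 2 := by
        rw [mul_pow, Real.sq_sqrt hl.le]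
      rw [h2, ← neg_sq ((m : ℝ) * s - w)]
      exact pow_le_pow_left₀ (by positivity) (by linarith) 2
    · rw [zero_mul]
      positivity
  nlinarith

/-- For `s < 1` the ratio of consecutive weights is s(m-w)/((1-s)(w+1)). Dropping 1 - s and
replacing `w` by `K` gives a lower bound that is uniform below `K`. -/
theorem mul_binom_le_binom_succ {s : ℝ} (h0 : 0 ≤ s) (h1 : s ≤ 1) {m w K : ℕ} (hw : w < K)
    (hK : K ≤ m) : s * (m - K) / (K + 1) * binom m s w ≤ binom m s (w + 1) := by
  have hc : (m.choose (w + 1) : ℝ) * (w + 1) = m.choose w * (m - w) := by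
    have := Nat.choose_succ_right_eq m w
    rw [← Nat.cast_sub (by omega)]
    exact_mod_cast this
  obtain ⟨d, rfl⟩ : ∃ d, m = w + 1 + d := ⟨m - (w + 1), by omega⟩
  unfold binom
  have e1 : w + 1 + d - w = d + 1 := by omega
  have e2 : w + 1 + d - (w + 1) = d := by omega
  rw [e1, e2]
  set a := ((w + 1 + d).choose (w + 1) : ℝ)
  set b := ((w + 1 + d).choose w : ℝ)
  have hb : 0 ≤ b := by positivity
  have hs : 0 ≤ 1 - s := by linarith
  have hwK : ((w : ℝ) + 1) ≤ K := by exact_mod_cast hw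
  have hKm : (K : ℝ) ≤ ((w + 1 + d : ℕ) : ℝ) := by exact_mod_cast hK
  have hab : b * (((w + 1 + d : ℕ) : ℝ) - K) ≤ a * (K + 1) := by
    have ha : 0 ≤ a := by positivity
    nlinarith
  rw [div_mul_eq_mul_div, div_le_iff₀ (by positivity)]
  have hp : (1 - s) ^ (d + 1) ≤ (1 - s) ^ d := pow_le_pow_of_le_one hs (by linarith) (by omega)
  calc s * (((w + 1 + d : ℕ) : ℝ) - K) * (b * s ^ w * (1 - s) ^ (d + 1))
      ≤ s * (((w + 1 + d : ℕ) : ℝ) - K) * (b * s ^ w * (1 - s) ^ d) := by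
        refine mul_le_mul_of_nonneg_left ?_ (mul_nonneg h0 (by linarith))
        exact mul_le_mul_of_nonneg_left hp (by positivity)
    _ = b * (((w + 1 + d : ℕ) : ℝ) - K) * (s ^ (w + 1) * (1 - s) ^ d) := by ring
    _ ≤ a * (K + 1) * (s ^ (w + 1) * (1 - s) ^ d) :=
        mul_le_mul_of_nonneg_right hab (by positivity)
    _ = _ := by ring

theorem pow_mul_binom_le_binom_add {s : ℝ} (h0 : 0 ≤ s) (h1 : s ≤ 1) {m K : ℕ} (hK : K ≤ m)
    (d : ℕ) {w : ℕ} (hw : w + d ≤ K) :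
    (s * (m - K) / (K + 1)) ^ d * binom m s w ≤ binom m s (w + d) := by
  have hk : (0 : ℝ) ≤ s * (m - K) / (K + 1) := by
    have : (K : ℝ) ≤ m := by exact_mod_cast hK
    have : 0 ≤ (m : ℝ) - K := by linarith
    positivity
  induction d with
  | zero => simp
  | succ d ih =>
    calc _ = s * (m - K) / (K + 1) * ((s * (m - K) / (K + 1)) ^ d * binom m s w) := by ring
      _ ≤ s * (m - K) / (K + 1) * binom m s (w + d) :=
        mul_le_mul_of_nonneg_left (ih (by omega)) hk
      _ ≤ _ := mul_binom_le_binom_succ h0 h1 (by omega) hK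

theorem pow_mul_sum_le_binomTail {s : ℝ} (h0 : 0 ≤ s) (h1 : s ≤ 1) {m K : ℕ} (hK : K ≤ m)
    (t d : ℕ) :
    (s * (m - K) / (K + 1)) ^ d *
      (∑ w ∈ Finset.range (m + 1), if t ≤ w ∧ w + d ≤ K then binom m s w else 0) ≤
      binomTail m s (t + d) := by
  unfold binomTail
  rw [← Finset.sum_filter, ← Finset.sum_filter, Finset.mul_sum]
  calc _ ≤ ∑ w ∈ Finset.range (m + 1) with t ≤ w ∧ w + d ≤ K, binom m s (w + d) :=
        Finset.sum_le_sum fun w hw =>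
          pow_mul_binom_le_binom_add h0 h1 hK d (Finset.mem_filter.1 hw).2.2
    _ = ∑ w ∈ (Finset.range (m + 1) |>.filter fun w => t ≤ w ∧ w + d ≤ K).map
          (addRightEmbedding d), binom m s w := by
        rw [Finset.sum_map]; rfl
    _ ≤ _ := by
        refine Finset.sum_le_sum_of_subset_of_nonneg ?_ fun w _ _ => binom_nonneg h0 h1 _ _
        intro w hw
        simp only [Finset.mem_map, Finset.mem_filter, Finset.mem_range,
          addRightEmbedding_apply] at hw ⊢
        omega

/-- The upper tail of the binomial distribution does not decay abruptly beyond a quantile. -/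
theorem exists_binomTail_gap {η : ℝ} (hη0 : 0 < η) (hη1 : η < 1) (D : ℕ) {S : ℝ} (hS : S < 1) :
    ∃ M : ℕ, ∃ κ > 0, ∀ m ≥ M, ∀ s, 0 < s → s ≤ S →
      ∃ t, binomTail m s t ≤ η ∧ κ * min (m * s) 1 ^ (D + 1) ≤ binomTail m s (t + D) := by
  -- Chebyshev with this `A` leaves mass at most η/2 above the level `L` below.
  set A := √(2 / η) with hA
  have hA0 : 0 < A := Real.sqrt_pos.2 (by positivity)
  have hA2 : 1 / A ^ 2 = η / 2 := by
    rw [hA, Real.sq_sqrt (by positivity)]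
    field_simp
  set B := A + D + 3 with hB
  have hB0 : 0 < B := by positivity
  -- This makes `m - K` at least m(1-S)/2, so the ratio bound below `K` is of order s·m/(K+1).
  have hlim : Tendsto (fun m : ℕ => √(m : ℝ) * ((1 - S) / 2 * √(m : ℝ) - A)) atTop atTop := by
    have h1 : Tendsto (fun m : ℕ => √(m : ℝ)) atTop atTop :=
      Real.tendsto_sqrt_atTop.comp tendsto_natCast_atTop_atTop
    refine h1.atTop_mul_atTop₀ ?_
    exact tendsto_atTop_add_const_right _ (-A) (h1.const_mul_atTop (by linarith))
  obtain ⟨M, hM⟩ := eventually_atTop.1 ((hlim.eventually_ge_atTop ((D : ℝ) + 1)).and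
    (eventually_gt_atTop 0))
  refine ⟨M, ((1 - S) / (4 * B)) ^ (D + 1) * (η / 2), ?_, fun m hm s hs0 hsS => ?_⟩
  · have : 0 < 1 - S := by linarith
    positivity
  obtain ⟨hm1, hm0⟩ := hM m hm
  have hs1 : s ≤ 1 := by linarith
  have hmR : (0 : ℝ) < m := by exact_mod_cast hm0
  have hl : 0 < m * s := by positivity
  set L := m * s + A * √(m * s) with hL
  have hL0 : 0 ≤ L := by positivity
  -- Every weight up to level `L` can be moved up by `D + 1` without passing `K`.
  set K := ⌊L⌋₊ + (D + 1) with hK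
  have hsqm : √(m : ℝ) * √(m : ℝ) = m := Real.mul_self_sqrt hmR.le
  have hKL : (K : ℝ) ≤ L + D + 1 := by
    rw [hK]; push_cast
    have := Nat.floor_le hL0
    linarith
  have hLm : L ≤ m * S + A * √m := by
    have h1 : m * s ≤ m * S := mul_le_mul_of_nonneg_left hsS hmR.le
    have h2 : √(m * s) ≤ √m := Real.sqrt_le_sqrt (by nlinarith)
    have := mul_le_mul_of_nonneg_left h2 hA0.le
    linarith
  have hmK : m * (1 - S) / 2 ≤ m - K := by nlinarith
  have hKm : K ≤ m := by
    have h1 : 0 ≤ m * (1 - S) / 2 := by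
      have : 0 < 1 - S := by linarith
      positivity
    have : (K : ℝ) ≤ m := by linarith
    exact_mod_cast this
  have hK1 : (K : ℝ) + 1 ≤ B * (m * s + 1) := by
    have h2 : √(m * s) ≤ m * s + 1 := by
      rw [Real.sqrt_le_left (by positivity)]
      nlinarith
    have h3 := mul_le_mul_of_nonneg_left h2 hA0.le
    have h4 : 0 ≤ (D + 3 : ℝ) * (m * s) := by positivity
    rw [hB]
    nlinarith
  have hk : (1 - S) / (4 * B) * min (m * s) 1 ≤ s * (m - K) / (K + 1) := by
    have h1 : min (m * s) 1 * (m * s + 1) ≤ 2 * (m * s) := by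
      rcases le_total (m * s) 1 with h | h
      · rw [min_eq_left h]; nlinarith
      · rw [min_eq_right h]; linarith
    rw [le_div_iff₀ (by positivity), div_mul_eq_mul_div, div_mul_eq_mul_div,
      div_le_iff₀ (by positivity)]
    have hmin : 0 ≤ min (m * s) 1 := by positivity
    have hS' : 0 ≤ 1 - S := by linarith
    calc (1 - S) * min (m * s) 1 * (K + 1) ≤ (1 - S) * min (m * s) 1 * (B * (m * s + 1)) :=
          mul_le_mul_of_nonneg_left hK1 (by positivity)
      _ = (1 - S) * B * (min (m * s) 1 * (m * s + 1)) := by ring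
      _ ≤ (1 - S) * B * (2 * (m * s)) := mul_le_mul_of_nonneg_left h1 (by positivity)
      _ = s * (m * (1 - S) / 2) * (4 * B) := by ring
      _ ≤ s * (m - K) * (4 * B) := by gcongr
  have hex : ∃ t, binomTail m s t ≤ η := by
    refine ⟨m + 1, ?_⟩
    unfold binomTail
    rw [Finset.sum_eq_zero]
    · exact hη0.le
    · intro w hw
      rw [if_neg]
      have := Finset.mem_range.1 hw
      omega
  classical
  have hpos : Nat.find hex ≠ 0 := by
    intro h0
    have := Nat.find_spec hex
    rw [h0, binomTail_zero] at this
    linarith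
  -- The least level with tail at most η is `t + 1`. The tail at `t` still exceeds η, so mass η/2
  -- lies between `t` and `L`; reaching `t + 1 + D` from there takes `D + 1` steps, hence the
  -- exponent.
  obtain ⟨t, ht⟩ := Nat.exists_eq_succ_of_ne_zero hpos
  refine ⟨t + 1, by simpa [ht] using Nat.find_spec hex, ?_⟩
  have htail : η < binomTail m s t := not_le.1 (Nat.find_min hex (by omega))
  have hmid : η / 2 ≤
      ∑ w ∈ Finset.range (m + 1), if t ≤ w ∧ w + (D + 1) ≤ K then binom m s w else 0 := by
    have h1 := sum_binom_ge_le hs0 hs1 hm0 hA0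
    rw [hA2] at h1
    have h2 : binomTail m s t ≤
        (∑ w ∈ Finset.range (m + 1), if t ≤ w ∧ w + (D + 1) ≤ K then binom m s w else 0) +
        ∑ w ∈ Finset.range (m + 1), if m * s + A * √(m * s) ≤ w then binom m s w else 0 := by
      unfold binomTail
      rw [← Finset.sum_add_distrib]
      refine Finset.sum_le_sum fun w _ => ?_
      have hb := binom_nonneg hs0.le hs1 m w
      by_cases hw : L ≤ w
      · rw [if_pos (c := m * s + A * √(m * s) ≤ w) hw]
        split_ifs <;> linarith
      · have : w ≤ ⌊L⌋₊ := Nat.le_floor (not_le.1 hw).le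
        have h3 : w + (D + 1) ≤ K := by omega
        simp only [h3, and_true]
        split_ifs <;> linarith
    linarith
  have hk0 : 0 ≤ (1 - S) / (4 * B) * min (m * s) 1 := by
    have : 0 ≤ 1 - S := by linarith
    positivity
  calc ((1 - S) / (4 * B)) ^ (D + 1) * (η / 2) * min (m * s) 1 ^ (D + 1)
      = ((1 - S) / (4 * B) * min (m * s) 1) ^ (D + 1) * (η / 2) := by rw [mul_pow]; ring
    _ ≤ (s * (m - K) / (K + 1)) ^ (D + 1) * _ :=
        mul_le_mul (pow_le_pow_left₀ hk0 hk _) hmid (by positivity)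
          (pow_nonneg (hk0.trans hk) _)
    _ ≤ binomTail m s (t + (D + 1)) := pow_mul_sum_le_binomTail hs0.le hs1 hKm t (D + 1)
    _ = binomTail m s (t + 1 + D) := by rw [add_right_comm, add_assoc]

end Binomial

/-! ### Exponential moments of counts. -/

section Chernoff

variable {ι κ β : Type*} [Fintype ι] [DecidableEq ι] [Fintype κ] [DecidableEq κ] [Fintype β]

/-- Exponential Markov inequality; the sign of `l` is free, so that it serves both tails. -/
theorem Pr_le_exp_mul_Ex {w : ι → β → ℝ} (hw : IsWeight w) (N : (ι → β) → ℝ) (l τ : ℝ)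
    {E : Set (ι → β)} (hE : ∀ y ∈ E, l * τ ≤ l * N y) :
    Pr w E ≤ Real.exp (-(l * τ)) * Ex w (fun y => Real.exp (l * N y)) := by
  rw [← Ex_mul_left]
  refine Pr_le_Ex hw (fun y => by positivity) fun y hy => ?_
  rw [← Real.exp_add, Real.one_le_exp_iff]
  linarith [hE y hy]

theorem exp_mul_card_filter (l : ℝ) (P : κ → Prop) [DecidablePred P] :
    Real.exp (l * (Finset.univ.filter P).card) =
      ∏ j, (1 + (Real.exp l - 1) * if P j then 1 else 0) := by
  rw [mul_comm, ← nsmul_eq_mul, Real.exp_nsmul, ← Finset.prod_const, Finset.prod_filter]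
  refine Finset.prod_congr rfl fun j _ => ?_
  split_ifs <;> ring

/-- The exponential of a count is a product of independent factors, and 1 + x ≤ exp x bounds each
mean by its Poisson counterpart. -/
theorem Ex_exp_count_row_le {w : ι × κ → β → ℝ} (hw : IsWeight w) (a : ι) (l : ℝ)
    (P : κ → β → Prop) [∀ j b, Decidable (P j b)] (π : κ → ℝ)
    (hπ : ∀ j, ∑ b, w (a, j) b * (if P j b then 1 else 0) = π j) :
    Ex w (fun y => Real.exp (l * (Finset.univ.filter fun j => P j (y (a, j))).card)) ≤
      Real.exp ((Real.exp l - 1) * ∑ j, π j) := by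
  simp only [exp_mul_card_filter]
  rw [Ex_prod_row hw a fun j b => 1 + (Real.exp l - 1) * if P j b then 1 else 0, Finset.mul_sum,
    Real.exp_sum]
  have h : ∀ j, (∑ b, w (a, j) b * (1 + (Real.exp l - 1) * if P j b then 1 else 0)) =
      (Real.exp l - 1) * π j + 1 := by
    intro j
    rw [← hπ, Finset.mul_sum]
    simp only [mul_add, mul_one, Finset.sum_add_distrib, hw.sum_eq_one]
    rw [add_comm]
    congr 1
    exact Finset.sum_congr rfl fun b _ => by ring
  refine Finset.prod_le_prod (fun j _ => Finset.sum_nonneg fun b _ =>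
    mul_nonneg (hw.nonneg _ _) ?_) fun j _ => ?_
  · have := Real.exp_pos l
    split_ifs <;> linarith
  · rw [h]
    exact Real.add_one_le_exp _

theorem Ex_exp_count_two_rows_le {w : ι × κ → β → ℝ} (hw : IsWeight w) {a a' : ι} (haa : a ≠ a')
    (l : ℝ) (P : κ → β → β → Prop) [∀ j b b', Decidable (P j b b')] (π : κ → ℝ)
    (hπ : ∀ j, ∑ b, ∑ b', w (a, j) b * w (a', j) b' * (if P j b b' then 1 else 0) = π j) :
    Ex w (fun y => Real.exp (l * (Finset.univ.filter fun j => P j (y (a, j)) (y (a', j))).card)) ≤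
      Real.exp ((Real.exp l - 1) * ∑ j, π j) := by
  simp only [exp_mul_card_filter]
  rw [Ex_prod_two_rows hw haa fun j b b' => 1 + (Real.exp l - 1) * if P j b b' then 1 else 0,
    Finset.mul_sum, Real.exp_sum]
  have h : ∀ j, (∑ b, ∑ b', w (a, j) b * w (a', j) b' *
      (1 + (Real.exp l - 1) * if P j b b' then 1 else 0)) = (Real.exp l - 1) * π j + 1 := by
    intro j
    rw [← hπ, Finset.mul_sum]
    have h1 : ∑ b, ∑ b', w (a, j) b * w (a', j) b' = 1 := by
      simp only [← Finset.mul_sum, hw.sum_eq_one, mul_one]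
    rw [← h1, ← Finset.sum_add_distrib]
    refine Finset.sum_congr rfl fun b _ => ?_
    rw [Finset.mul_sum, ← Finset.sum_add_distrib]
    exact Finset.sum_congr rfl fun b' _ => by rw [h1]; ring
  refine Finset.prod_le_prod (fun j _ => Finset.sum_nonneg fun b _ => Finset.sum_nonneg fun b' _ =>
    mul_nonneg (mul_nonneg (hw.nonneg _ _) (hw.nonneg _ _)) ?_) fun j _ => ?_
  · have := Real.exp_pos l
    split_ifs <;> linarith
  · rw [h]
    exact Real.add_one_le_exp _

theorem exp_sub_one_le {l : ℝ} (hl : |l| ≤ 1) : Real.exp l - 1 ≤ l + l ^ 2 := by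
  have := (abs_le.1 (Real.abs_exp_sub_one_sub_id_le hl)).2
  linarith

end Chernoff

/-! ### The law of one column and its likelihood ratio. -/

section Popularity

variable {ι : Type*} [Fintype ι] [DecidableEq ι]

/-- The law of a column with independent bits that are `true` with probability `s` in the rows
of `S`, and `false` elsewhere. -/
def columnWeight (S : Finset ι) (s : ℝ) (b : ι → Bool) : ℝ :=
  ∏ i, if i ∈ S then (if b i then s else 1 - s) else (if b i then 0 else 1)

theorem columnWeight_eq (S : Finset ι) (s : ℝ) (b : ι → Bool) :
    columnWeight S s b = if ∀ i ∉ S, b i = false then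
      s ^ (S.filter fun i => b i = true).card *
        (1 - s) ^ (S.card - (S.filter fun i => b i = true).card) else 0 := by
  unfold columnWeight
  split_ifs with h
  · have h1 : ∀ i, (if i ∈ S then (if b i then s else 1 - s) else (if b i then 0 else 1)) =
        if i ∈ S then (if b i then s else 1 - s) else 1 := by
      intro i
      by_cases hi : i ∈ S
      · simp [hi]
      · simp [hi, h i hi]
    have h2 := Finset.card_filter_add_card_filter_not (s := S) (fun i => b i = true)
    simp only [h1]
    rw [Finset.prod_ite_mem, Finset.univ_inter, Finset.prod_ite, Finset.prod_const,
      Finset.prod_const]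
    congr 2
    omega
  · push Not at h
    obtain ⟨i, hi, hb⟩ := h
    exact Finset.prod_eq_zero (Finset.mem_univ i) (by simp [hi, hb])

/-- The weight of a column is supported on the subsets of `S` and depends on their size only, so
grouping by size produces the binomial law. -/
theorem sum_columnWeight_mul (S : Finset ι) (s : ℝ) (F : ℕ → ℝ) :
    ∑ b, columnWeight S s b * F (S.filter fun i => b i = true).card =
      ∑ w ∈ Finset.range (S.card + 1), binom S.card s w * F w := by
  classical
  have h1 : ∑ b, columnWeight S s b * F (S.filter fun i => b i = true).card =
      ∑ T ∈ S.powerset, s ^ T.card * (1 - s) ^ (S.card - T.card) * F T.card := by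
    simp only [columnWeight_eq, ite_mul, zero_mul]
    rw [← Finset.sum_filter]
    refine Finset.sum_nbij' (fun b => S.filter fun i => b i = true) (fun T i => decide (i ∈ T))
      (fun b _ => Finset.mem_powerset.2 (Finset.filter_subset _ _)) ?_ ?_ ?_ fun b _ => rfl
    · intro T hT
      have := Finset.mem_powerset.1 hT
      simp only [Finset.mem_filter, Finset.mem_univ, true_and]
      intro i hi
      simpa using fun h => hi (this h)
    · intro b hb
      have := (Finset.mem_filter.1 hb).2
      funext i
      by_cases hi : i ∈ S
      · simp [hi]
      · simp [hi, this i hi]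
    · intro T hT
      have := Finset.mem_powerset.1 hT
      ext i
      simpa using fun h => this h
  rw [h1, Finset.sum_powerset_apply_card (fun c => s ^ c * (1 - s) ^ (S.card - c) * F c)]
  refine Finset.sum_congr rfl fun w _ => ?_
  rw [nsmul_eq_mul, binom]
  ring

theorem columnWeight_nonneg (S : Finset ι) {s : ℝ} (h0 : 0 ≤ s) (h1 : s ≤ 1) (b : ι → Bool) :
    0 ≤ columnWeight S s b := by
  refine Finset.prod_nonneg fun i _ => ?_
  split_ifs <;> linarith

theorem sum_columnWeight (S : Finset ι) (s : ℝ) : ∑ b, columnWeight S s b = 1 := by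
  have := sum_columnWeight_mul S s fun _ => 1
  simpa [sum_binom] using this

/-- Exchanging the two columns multiplies the likelihood by the odds ratio to the power of the lead;
with ρ ≤ 1, a lead of at least `D` gives ρ^D. -/
theorem columnWeight_mul_le (S : Finset ι) {s₀ s₁ ρ : ℝ} (h0 : 0 ≤ s₀) (h0' : s₀ ≤ 1)
    (h1 : 0 ≤ s₁) (h1' : s₁ ≤ 1) (hρ0 : 0 ≤ ρ) (hρ1 : ρ ≤ 1)
    (hs : s₀ * (1 - s₁) ≤ ρ * (s₁ * (1 - s₀))) {D : ℕ} {b b' : ι → Bool}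
    (hb : (S.filter fun i => b' i = true).card + D ≤ (S.filter fun i => b i = true).card) :
    columnWeight S s₀ b * columnWeight S s₁ b' ≤
      ρ ^ D * (columnWeight S s₁ b * columnWeight S s₀ b') := by
  have hm : (S.filter fun i => b i = true).card ≤ S.card :=
    Finset.card_le_card (Finset.filter_subset _ _)
  simp only [columnWeight_eq]
  by_cases hb1 : ∀ i ∉ S, b i = false
  swap
  · simp [hb1]
  by_cases hb2 : ∀ i ∉ S, b' i = false
  swap
  · simp [hb2]
  rw [if_pos hb1, if_pos hb2, if_pos hb1, if_pos hb2]
  obtain ⟨d, hd⟩ := Nat.exists_eq_add_of_le hb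
  obtain ⟨c, hc⟩ := Nat.exists_eq_add_of_le hm
  set u := (S.filter fun i => b' i = true).card
  set v := (S.filter fun i => b i = true).card
  have e1 : S.card - v = c := by omega
  have e2 : S.card - u = c + (D + d) := by omega
  have e3 : v = u + (D + d) := by omega
  rw [e1, e2, e3]
  have h2 : 0 ≤ 1 - s₀ := by linarith
  have h3 : 0 ≤ 1 - s₁ := by linarith
  calc _ = (s₀ * s₁) ^ u * ((1 - s₀) * (1 - s₁)) ^ c * (s₀ * (1 - s₁)) ^ (D + d) := by
        simp only [mul_pow, pow_add]; ring
    _ ≤ (s₀ * s₁) ^ u * ((1 - s₀) * (1 - s₁)) ^ c * (ρ ^ D * (s₁ * (1 - s₀)) ^ (D + d)) := by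
        refine mul_le_mul_of_nonneg_left ?_ (by positivity)
        refine (pow_le_pow_left₀ (by positivity) hs _).trans ?_
        rw [mul_pow]
        refine mul_le_mul_of_nonneg_right ?_ (by positivity)
        exact pow_le_pow_of_le_one hρ0 hρ1 (by omega)
    _ = _ := by simp only [mul_pow, pow_add]; ring

end Popularity

/-! ### From observed entries to independent binomial columns. -/

section Cells

variable {ι κ : Type*} [Fintype ι] [DecidableEq ι] [Fintype κ] [DecidableEq κ]

/-- The law of an observed entry with true rating `a`; it is observed with probability `q`. -/
def cellWeight (p q : ℝ) (a : Bool) : Option Bool → ℝ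
  | none => 1 - q
  | some b => q * if b = a then 1 - p else p

theorem isWeight_cell {p q : ℝ} (hp0 : 0 ≤ p) (hp1 : p ≤ 1) (hq0 : 0 ≤ q) (hq1 : q ≤ 1)
    (X : ι → κ → Bool) : IsWeight fun c : ι × κ => cellWeight p q (X c.1 c.2) where
  nonneg c b := by
    rcases b with _ | b
    · exact sub_nonneg.2 hq1
    · simp only [cellWeight]
      split_ifs
      · exact mul_nonneg hq0 (by linarith)
      · exact mul_nonneg hq0 hp0
  sum_eq_one c := by
    rw [Fintype.sum_option]
    cases X c.1 c.2 <;> simp [cellWeight] <;> ring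

theorem topCols_congr {β γ : Type*} {U : Finset κ} {W : β → ℕ} {W' : γ → ℕ} {y : κ → β}
    {y' : κ → γ} (h : ∀ j ∈ U, W (y j) = W' (y' j)) : topCols U W y = topCols U W' y' := by
  ext j
  simp only [topCols, Finset.mem_filter]
  refine and_congr_right fun hj => forall₂_congr fun l hl => ?_
  rw [h j hj, h l hl]

theorem falseFraction_congr {β γ : Type*} {x : κ → Bool} {U : Finset κ} {W : β → ℕ} {W' : γ → ℕ}
    {y : κ → β} {y' : κ → γ} (h : ∀ j ∈ U, W (y j) = W' (y' j)) :
    falseFraction x U W y = falseFraction x U W' y' := by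
  unfold falseFraction
  rw [topCols_congr h]

/-- The number of ones in the rows of `S`. -/
def countTrue (S : Finset ι) (b : ι → Bool) : ℕ := (S.filter fun i => b i = true).card

theorem dependsOn_falseFraction {α : Type*} (x : κ → Bool) (S : Finset ι) (U : Finset κ)
    (φ : α → Bool) :
    DependsOn (fun y : ι × κ → α => falseFraction x U (countTrue S) fun j i => φ (y (i, j)))
      {c | c.1 ∈ S ∧ c.2 ∈ U} := by
  intro y y' h
  refine falseFraction_congr fun j hj => ?_
  unfold countTrue
  congr 1
  refine Finset.filter_congr fun i hi => ?_
  beta_reduce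
  rw [h (i, j) ⟨hi, hj⟩]

theorem card_mul_Ex_falseFraction_cell_le {p q : ℝ} (hp0 : 0 ≤ p) (hp : p < 1 / 2) (hq0 : 0 ≤ q)
    (hq1 : q ≤ 1) (X : ι → κ → Bool) (x : κ → Bool) (S : Finset ι) (U : Finset κ)
    (hX : ∀ i ∈ S, ∀ j ∈ U, X i j = x j) (t D : ℕ) :
    ((U.filter fun j => x j = true).card : ℝ) *
      Ex (fun c : ι × κ => cellWeight p q (X c.1 c.2)) (fun y =>
        falseFraction x U (countTrue S) fun j i => decide (y (i, j) = some true)) ≤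
    (U.filter fun j => x j = false).card * (p / (1 - p)) ^ D +
      (U.filter fun j => x j = true).card * (binomTail S.card (q * (1 - p)) t +
        (1 - binomTail S.card (q * (1 - p)) (t + D)) ^ (U.filter fun j => x j = true).card) := by
  set s : Bool → ℝ := fun a => q * if a = true then 1 - p else p with hs
  have hs0 : ∀ a, 0 ≤ s a := by
    intro a
    simp only [hs]
    split_ifs
    · exact mul_nonneg hq0 (by linarith)
    · exact mul_nonneg hq0 hp0
  have hs1 : ∀ a, s a ≤ 1 := by
    intro a
    simp only [hs]
    split_ifs <;> nlinarith
  have hw := isWeight_cell hp0 (by linarith) hq0 hq1 X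
  -- Only the entries in `S` and `U` matter, so the law elsewhere may be replaced; with `false`
  -- outside `S`, each column has exactly the law `columnWeight`.
  set w' : ι × κ → Bool → ℝ := fun c b =>
    if c.1 ∈ S then (if b then s (x c.2) else 1 - s (x c.2)) else (if b then 0 else 1) with hw'
  have hw'w : IsWeight w' := by
    refine ⟨fun c b => ?_, fun c => ?_⟩
    · have h0 := hs0 (x c.2)
      have h1 := hs1 (x c.2)
      simp only [hw']
      split_ifs <;> linarith
    · simp only [hw']
      split_ifs <;> simp
  have hmapw : IsWeight (fun (c : ι × κ) (a : Bool) => ∑ b, if decide (b = some true) = a then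
      cellWeight p q (X c.1 c.2) b else 0) := by
    refine ⟨fun c a => Finset.sum_nonneg fun b _ => ?_, fun c => ?_⟩
    · split_ifs
      exacts [hw.nonneg c b, le_rfl]
    · rw [Finset.sum_comm]
      simpa using hw.sum_eq_one c
  have hdep : DependsOn (fun v : ι × κ → Bool => falseFraction x U (countTrue S)
      fun j i => v (i, j)) {c | c.1 ∈ S ∧ c.2 ∈ U} := dependsOn_falseFraction x S U id
  have e1 : Ex (fun c : ι × κ => cellWeight p q (X c.1 c.2)) (fun y =>
        falseFraction x U (countTrue S) fun j i => decide (y (i, j) = some true)) =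
      Ex (fun (j : κ) => columnWeight S (s (x j))) (falseFraction x U (countTrue S)) := by
    rw [Ex_map (fun c : ι × κ => cellWeight p q (X c.1 c.2)) (fun _ b => decide (b = some true))
      (fun v => falseFraction x U (countTrue S) fun j i => v (i, j)),
      Ex_congr_weight hmapw hw'w ?_ hdep, Ex_curry]
    · rfl
    · rintro ⟨i, j⟩ ⟨hi, hj⟩
      funext a
      simp only [hw', if_pos hi, hX i hi j hj, Fintype.sum_option, hs]
      cases a <;> cases x j <;> simp [cellWeight] <;> ring
  rw [e1]
  have hpp : 0 < 1 - p := by linarith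
  have hρ0 : 0 ≤ p / (1 - p) := by positivity
  have hρ1 : p / (1 - p) ≤ 1 := by
    rw [div_le_one hpp]; linarith
  -- The right side equals qp(1-qp), and 1 - q(1-p) ≤ 1 - qp because p < 1/2.
  have hsρ : s false * (1 - s true) ≤ p / (1 - p) * (s true * (1 - s false)) := by
    simp only [hs]
    have : p / (1 - p) * (q * (1 - p) * (1 - q * p)) = q * p * (1 - q * p) := by
      field_simp
    simp only [if_true, Bool.false_eq_true, if_false]
    rw [this]
    refine mul_le_mul_of_nonneg_left ?_ (mul_nonneg hq0 hp0)
    nlinarith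
  have main := card_mul_Ex_falseFraction_le (μ := fun a => columnWeight S (s a))
    (W := countTrue S) (D := D) (θ := (p / (1 - p)) ^ D)
    (fun a => ⟨columnWeight_nonneg S (hs0 a) (hs1 a), sum_columnWeight S _⟩) (by positivity)
    (fun b b' hb => columnWeight_mul_le S (hs0 _) (hs1 _) (hs0 _) (hs1 _) hρ0 hρ1 hsρ hb) x U t
  have e2 : (∑ b, if t ≤ countTrue S b then columnWeight S (s true) b else 0) =
      binomTail S.card (q * (1 - p)) t := by
    have := sum_columnWeight_mul S (s true) fun w => if t ≤ w then 1 else 0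
    simp only [mul_ite, mul_one, mul_zero] at this
    exact this
  have e3 : (∑ b, if t + D ≤ countTrue S b then 0 else columnWeight S (s true) b) =
      1 - binomTail S.card (q * (1 - p)) (t + D) := by
    have := sum_columnWeight_mul S (s true) fun w => if t + D ≤ w then 0 else 1
    simp only [mul_ite, mul_one, mul_zero] at this
    refine Eq.trans this ?_
    rw [eq_sub_iff_add_eq, binomTail, ← Finset.sum_add_distrib]
    refine Eq.trans ?_ (sum_binom S.card (q * (1 - p)))
    refine Finset.sum_congr rfl fun w _ => ?_
    simp only [hs, if_true]
    split_ifs <;> simp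
  rw [e2, e3] at main
  exact main

end Cells

/-! ### Independence of the row selection and the unobserved columns. -/

section Algorithm

variable {n T : ℕ} [NeZero n]

/-- The probability that `PAF(T)` fails if the first row of ratings is `x` and the observed matrix
is `y`. -/
noncomputable def errorOf (τ : TopRule n T) (x : Fin n → Bool)
    (y : Fin n → Fin n → Option Bool) : ℝ :=
  ((paf τ y).toOuterMeasure {o | ∀ j ∈ o, x j = false}).toReal

/-- The failure probability of the second step of the algorithm, given the selected rows. -/
noncomputable def recommendError (x : Fin n → Bool) (y : Fin n → Fin n → Option Bool)
    (S : Finset (Fin n)) : ℝ :=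
  ((recommend y S).toOuterMeasure {o | ∀ j ∈ o, x j = false}).toReal

/-- The columns that are unobserved for the first user. -/
def unobserved (y : Fin n → Fin n → Option Bool) : Finset (Fin n) :=
  Finset.univ.filter fun j => y 0 j = none

theorem toOuterMeasure_le_one {α : Type*} (P : PMF α) (E : Set α) : P.toOuterMeasure E ≤ 1 := by
  rw [← P.tsum_coe, P.toOuterMeasure_apply]
  exact ENNReal.tsum_le_tsum fun a => Set.indicator_le_self' (by simp) a

theorem errorOf_nonneg (τ : TopRule n T) (x : Fin n → Bool) (y : Fin n → Fin n → Option Bool) :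
    0 ≤ errorOf τ x y := ENNReal.toReal_nonneg

theorem errorOf_le_one (τ : TopRule n T) (x : Fin n → Bool) (y : Fin n → Fin n → Option Bool) :
    errorOf τ x y ≤ 1 :=
  ENNReal.toReal_le_of_le_ofReal zero_le_one (by
    rw [ENNReal.ofReal_one]
    exact toOuterMeasure_le_one _ _)

theorem errorOf_eq (τ : TopRule n T) (x : Fin n → Bool) (y : Fin n → Fin n → Option Bool) :
    errorOf τ x y = ∑ S, (τ.select (similarity y 0) S).toReal * recommendError x y S := by
  unfold errorOf paf recommendError
  rw [PMF.toOuterMeasure_bind_apply, tsum_fintype, ENNReal.toReal_sum]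
  · simp only [ENNReal.toReal_mul]
  · intro S _
    exact ENNReal.mul_ne_top (PMF.apply_ne_top _ _)
      (ne_top_of_le_ne_top ENNReal.one_ne_top (toOuterMeasure_le_one _ _))

theorem sum_select_toReal (τ : TopRule n T) (s : Fin n → ℕ) :
    ∑ S, (τ.select s S).toReal = 1 := by
  have h := (τ.select s).tsum_coe
  rw [tsum_fintype] at h
  rw [← ENNReal.toReal_sum fun S _ => PMF.apply_ne_top _ _, h, ENNReal.toReal_one]

/-- The first row has no ones in its own unobserved columns, so it can be erased from the selection.
This removes the only dependence of the popularities on that row. -/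
theorem mostPopular_eq_topCols (y : Fin n → Fin n → Option Bool) (S : Finset (Fin n)) :
    mostPopular y S = topCols (unobserved y) (countTrue (S.erase 0))
      fun j i => decide (y i j = some true) := by
  have h : ∀ j, y 0 j = none → popularity y S j =
      countTrue (S.erase 0) fun i => decide (y i j = some true) := by
    intro j hj
    unfold popularity countTrue
    congr 1
    ext i
    simp only [Finset.mem_filter, Finset.mem_erase, decide_eq_true_eq]
    constructor
    · rintro ⟨h1, h2⟩
      refine ⟨⟨?_, h1⟩, h2⟩
      rintro rfl
      simp [hj] at h2
    · rintro ⟨⟨_, h1⟩, h2⟩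
      exact ⟨h1, h2⟩
  ext j
  simp only [mostPopular, topCols, unobserved, Finset.mem_filter, Finset.mem_univ, true_and]
  refine and_congr_right fun hj => forall₂_congr fun l hl => ?_
  rw [h j hj, h l hl]

theorem recommendError_eq (x : Fin n → Bool) (y : Fin n → Fin n → Option Bool)
    (S : Finset (Fin n)) (hy : (unobserved y).Nonempty) :
    recommendError x y S = falseFraction x (unobserved y) (countTrue (S.erase 0))
      fun j i => decide (y i j = some true) := by
  have hne : (mostPopular y S).Nonempty := by
    obtain ⟨j, hj, hmax⟩ := (unobserved y).exists_max_image (popularity y S) hy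
    refine ⟨j, ?_⟩
    simp only [unobserved, Finset.mem_filter, Finset.mem_univ, true_and] at hj hmax
    simpa [mostPopular] using ⟨hj, hmax⟩
  unfold recommendError recommend falseFraction
  rw [dif_pos hne, PMF.toOuterMeasure_map_apply, PMF.toOuterMeasure_uniformOfFinset_apply,
    ENNReal.toReal_div, ENNReal.toReal_natCast, ENNReal.toReal_natCast, ← mostPopular_eq_topCols]
  congr 3
  ext j
  simp

/-- A column contributes to the similarity with the first row only if that row observes it, so the
entries of other rows in `u` are never read. -/
theorem dependsOn_similarity (u : Finset (Fin n)) (g : (Fin n → ℕ) → ℝ) :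
    DependsOn (fun y : Fin n × Fin n → Option Bool =>
      if unobserved (fun i j => y (i, j)) = u then g (similarity (fun i j => y (i, j)) 0) else 0)
      {c | c.1 = 0 ∨ c.2 ∉ u} := by
  intro y y' h
  have hu : unobserved (fun i j => y (i, j)) = unobserved (fun i j => y' (i, j)) := by
    unfold unobserved
    refine Finset.filter_congr fun j _ => ?_
    beta_reduce
    rw [h (0, j) (Or.inl rfl)]
  beta_reduce
  rw [hu]
  split_ifs with hu'
  · congr 1
    funext l
    unfold similarity
    congr 1
    refine Finset.filter_congr fun j _ => ?_
    beta_reduce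
    rw [h (0, j) (Or.inl rfl)]
    refine and_congr_right fun hj => ?_
    have : j ∉ u := by
      rw [← hu']
      simpa [unobserved] using hj
    rw [h (l, j) (Or.inr this)]
  · rfl

/-- The selected rows are independent of the ratings in the unobserved columns. Hence it suffices
to bound the error of the second step for every set of rows in `G`. -/
theorem Ex_errorOf_le {w : Fin n × Fin n → Option Bool → ℝ} (hw : IsWeight w) (τ : TopRule n T)
    (x : Fin n → Bool) (G : Set (Fin n)) {ν η : ℝ} (hν : 0 < ν) (hη : 0 ≤ η)
    (h : ∀ S : Finset (Fin n), S.card = T → (∀ i ∈ S, i ∈ G) → ∀ u : Finset (Fin n),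
      ν ≤ (u.filter fun j => x j = true).card →
      Ex w (fun y => falseFraction x u (countTrue (S.erase 0)) fun j i =>
        decide (y (i, j) = some true)) ≤ η) :
    Ex w (fun y => errorOf τ x fun i j => y (i, j)) ≤
      Pr w {y | ∃ S, IsTop T (similarity (fun i j => y (i, j)) 0) S ∧ ∃ i ∈ S, i ∉ G} +
      Pr w {y | ((Finset.univ.filter fun j => x j = true ∧ y (0, j) = none).card : ℝ) < ν} + η := by
  classical
  set E₁ : Set (Fin n × Fin n → Option Bool) :=
    {y | ∃ S, IsTop T (similarity (fun i j => y (i, j)) 0) S ∧ ∃ i ∈ S, i ∉ G} with hE₁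
  set E₂ : Set (Fin n × Fin n → Option Bool) :=
    {y | ((Finset.univ.filter fun j => x j = true ∧ y (0, j) = none).card : ℝ) < ν} with hE₂
  set A : Finset (Finset (Fin n)) :=
    Finset.univ.filter fun S => S.card = T ∧ ∀ i ∈ S, i ∈ G with hA
  set B : Finset (Finset (Fin n)) :=
    Finset.univ.filter fun u => ν ≤ (u.filter fun j => x j = true).card with hB
  -- `f S u` reads the first row and the columns outside `u`, while `e S u` reads other rows inside
  -- `u`: the two are independent. Summed over `S` and `u`, the `f S u` give at most 1.
  set f : Finset (Fin n) → Finset (Fin n) → (Fin n × Fin n → Option Bool) → ℝ := fun S u y =>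
    if unobserved (fun i j => y (i, j)) = u then
      (τ.select (similarity (fun i j => y (i, j)) 0) S).toReal else 0 with hf
  set e : Finset (Fin n) → Finset (Fin n) → (Fin n × Fin n → Option Bool) → ℝ := fun S u y =>
    falseFraction x u (countTrue (S.erase 0)) fun j i => decide (y (i, j) = some true) with he
  have hf0 : ∀ S u y, 0 ≤ f S u y := by
    intro S u y
    simp only [hf]
    split_ifs
    exacts [ENNReal.toReal_nonneg, le_rfl]
  have he0 : ∀ S u y, 0 ≤ e S u y := fun S u y => by
    simp only [he, falseFraction]
    positivity
  have hsum0 : ∀ y, 0 ≤ ∑ S ∈ A, ∑ u ∈ B, f S u y * e S u y := fun y =>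
    Finset.sum_nonneg fun S _ => Finset.sum_nonneg fun u _ => mul_nonneg (hf0 _ _ _) (he0 _ _ _)
  have hpt : ∀ y, errorOf τ x (fun i j => y (i, j)) ≤
      (E₁.indicator 1 y : ℝ) + E₂.indicator 1 y + ∑ S ∈ A, ∑ u ∈ B, f S u y * e S u y := by
    intro y
    have h1 := errorOf_le_one τ x fun i j => y (i, j)
    have h2 := hsum0 y
    have i1 : 0 ≤ (E₁.indicator 1 y : ℝ) := Set.indicator_nonneg (by simp) _
    have i2 : 0 ≤ (E₂.indicator 1 y : ℝ) := Set.indicator_nonneg (by simp) _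
    by_cases hy1 : y ∈ E₁
    · rw [Set.indicator_of_mem hy1, Pi.one_apply]
      linarith
    by_cases hy2 : y ∈ E₂
    · rw [Set.indicator_of_mem hy2, Pi.one_apply]
      linarith
    rw [Set.indicator_of_notMem hy1, Set.indicator_of_notMem hy2, zero_add, zero_add, errorOf_eq]
    have hcard : (Finset.univ.filter fun j => x j = true ∧ y (0, j) = none) =
        (unobserved (fun i j => y (i, j))).filter fun j => x j = true := by
      ext j
      simp [unobserved, and_comm]
    have hu : unobserved (fun i j => y (i, j)) ∈ B := by
      simp only [hE₂, Set.mem_ofPred_eq, not_lt, hcard] at hy2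
      simpa [hB] using hy2
    have hne : (unobserved (fun i j => y (i, j))).Nonempty := by
      have h3 : (0 : ℝ) < ((unobserved (fun i j => y (i, j))).filter fun j => x j = true).card :=
        hν.trans_le (Finset.mem_filter.1 hu).2
      exact (Finset.card_pos.1 (by exact_mod_cast h3)).mono (Finset.filter_subset _ _)
    have hS : ∀ S ∉ A, (τ.select (similarity (fun i j => y (i, j)) 0) S).toReal *
        recommendError x (fun i j => y (i, j)) S = 0 := by
      intro S hSA
      by_cases hs : S ∈ (τ.select (similarity (fun i j => y (i, j)) 0)).support
      · have htop := τ.isTop _ S hs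
        refine absurd (Finset.mem_filter.2 ⟨Finset.mem_univ _, htop.1, fun i hi => ?_⟩) hSA
        by_contra hiG
        exact hy1 ⟨S, htop, i, hi, hiG⟩
      · rw [PMF.mem_support_iff, not_not] at hs
        simp [hs]
    rw [← Finset.sum_subset (Finset.subset_univ A) fun S _ hSA => hS S hSA]
    refine Finset.sum_le_sum fun S _ => ?_
    rw [recommendError_eq _ _ _ hne]
    refine le_of_eq_of_le ?_ (Finset.single_le_sum
      (fun u _ => mul_nonneg (hf0 S u y) (he0 S u y)) hu)
    simp [hf, he]
  refine (Ex_mono hw hpt).trans ?_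
  rw [Ex_add, Ex_add]
  refine add_le_add_right ?_ _
  simp only [Ex_sum]
  have hfe : ∀ S ∈ A, ∀ u ∈ B, Ex w (fun y => f S u y * e S u y) ≤ Ex w (f S u) * η := by
    intro S hSA u huB
    have hSA' := (Finset.mem_filter.1 hSA).2
    rw [Ex_mul_of_dependsOn hw (A := {c | c.1 = 0 ∨ c.2 ∉ u})
      (dependsOn_similarity u fun s => (τ.select s S).toReal)]
    · exact mul_le_mul_of_nonneg_left (h S hSA'.1 hSA'.2 u (Finset.mem_filter.1 huB).2)
        (Ex_nonneg hw (hf0 S u))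
    · intro y y' hyy
      refine dependsOn_falseFraction x (S.erase 0) u (fun b => decide (b = some true)) fun c hc => ?_
      refine hyy c ?_
      rintro (h0 | h0)
      · exact (Finset.mem_erase.1 hc.1).1 h0
      · exact h0 hc.2
  refine (Finset.sum_le_sum fun S hS => Finset.sum_le_sum fun u hu => hfe S hS u hu).trans ?_
  simp only [← Finset.sum_mul]
  refine mul_le_of_le_one_left hη ?_
  simp only [← Ex_sum]
  refine Ex_le_of_le hw fun y => ?_
  rw [← sum_select_toReal τ (similarity (fun i j => y (i, j)) 0)]
  refine (Finset.sum_le_sum fun S _ => ?_).trans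
    (Finset.sum_le_sum_of_subset_of_nonneg (Finset.subset_univ A)
      fun S _ _ => ENNReal.toReal_nonneg)
  simp only [hf, Finset.sum_ite_eq]
  split_ifs
  exacts [le_rfl, ENNReal.toReal_nonneg]

end Algorithm

/-! ### Similarity scores separate agreeing rows from the others. -/

section Separation

variable {n T : ℕ} [NeZero n]

/-- Both entries are observed with probability q²; a differing rating replaces (1-p)² + p² by
2p(1-p), which is smaller by (1-2p)². -/
theorem sum_cellWeight_agree (p q : ℝ) (a a' : Bool) :
    ∑ b, ∑ b', cellWeight p q a b * cellWeight p q a' b' *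
      (if b ≠ none ∧ b' ≠ none ∧ b = b' then 1 else 0) =
      q ^ 2 * ((1 - p) ^ 2 + p ^ 2) - q ^ 2 * (1 - 2 * p) ^ 2 * (if a' ≠ a then 1 else 0) := by
  simp only [Fintype.sum_option, Fintype.sum_bool]
  cases a <;> cases a' <;> simp [cellWeight] <;> ring

theorem similarity_le_self (y : Fin n → Fin n → Option Bool) (i : Fin n) :
    similarity y 0 i ≤ similarity y 0 0 := by
  refine Finset.card_le_card fun j hj => ?_
  simp only [Finset.mem_filter, Finset.mem_univ, true_and] at hj ⊢
  exact ⟨hj.1, hj.1, trivial⟩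

/-- A selection of rows with top scores lies in `G` if the scores of the rows in `G` lie above a
level, and the scores of the other rows below it. -/
theorem subset_of_isTop {s : Fin n → ℕ} {τ : ℝ} {G : Finset (Fin n)} (hT : 2 ≤ T)
    (hG : T ≤ G.card) (hs0 : ∀ i, s i ≤ s 0)
    (hgood : ∀ i ∈ G, i ≠ 0 → τ < s i) (hbad : ∀ i ∉ G, s i < τ) {S : Finset (Fin n)}
    (hS : IsTop T s S) : ∀ i ∈ S, i ∈ G := by
  intro l hl
  by_contra hlG
  have hG' : ∀ i ∈ G, τ < s i := by
    intro i hi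
    by_cases h : i = 0
    -- Row 0 needs no estimate of its own: its score is the largest, and `G` contains another row
    -- above the level.
    · obtain ⟨i', hi', hne⟩ := Finset.exists_mem_ne (by omega : 1 < G.card) (0 : Fin n)
      refine (hgood i' hi' hne).trans_le ?_
      rw [h]
      exact_mod_cast hs0 i'
    · exact hgood i hi h
  obtain ⟨i, hiG, hiS⟩ : ∃ i ∈ G, i ∉ S := by
    by_contra hcon
    push Not at hcon
    have h1 : G ⊂ S := Finset.ssubset_iff_subset_ne.2 ⟨hcon, fun h => hlG (h ▸ hl)⟩
    have := Finset.card_lt_card h1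
    have := hS.1
    omega
  have h1 : (s i : ℝ) ≤ s l := by exact_mod_cast hS.2 l hl i hiS
  linarith [hG' i hiG, hbad l hlG]

/-- With x = δ(1-2p)², the level lies halfway between the mean for an agreeing row and the largest
mean allowed for a differing one. The choice |l| = x/4 minimizes l² - |l|x/2, which gives the
exponent x²/16. -/
theorem Pr_similarity_le {p q : ℝ} (hp0 : 0 ≤ p) (hp1 : p ≤ 1) (hq0 : 0 ≤ q) (hq1 : q ≤ 1)
    (X : Fin n → Fin n → Bool) {δ : ℝ} (hδ0 : 0 ≤ δ) (hδ1 : δ ≤ 1) {i : Fin n} (hi : i ≠ 0)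
    {E : Set (Fin n × Fin n → Option Bool)} {l : ℝ}
    (hl : (l = -(δ * (1 - 2 * p) ^ 2 / 4) ∧ ∀ j, X i j = X 0 j) ∨
      (l = δ * (1 - 2 * p) ^ 2 / 4 ∧
        δ * n ≤ (Finset.univ.filter fun j => X i j ≠ X 0 j).card))
    (hE : ∀ y ∈ E, l * (n * q ^ 2 * ((1 - p) ^ 2 + p ^ 2 - δ * (1 - 2 * p) ^ 2 / 2)) ≤
      l * similarity (fun i j => y (i, j)) 0 i) :
    Pr (fun c : Fin n × Fin n => cellWeight p q (X c.1 c.2)) E ≤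
      Real.exp (-(n * q ^ 2 * (δ * (1 - 2 * p) ^ 2) ^ 2 / 16)) := by
  have hw := isWeight_cell hp0 hp1 hq0 hq1 X
  refine (Pr_le_exp_mul_Ex hw _ l _ hE).trans ?_
  have h1 := Ex_exp_count_two_rows_le hw hi.symm l
    (fun _ b b' => b ≠ none ∧ b' ≠ none ∧ b = b') _
    (fun j => sum_cellWeight_agree p q (X 0 j) (X i j))
  refine (mul_le_mul_of_nonneg_left h1 (Real.exp_pos _).le).trans ?_
  rw [← Real.exp_add, Real.exp_le_exp, Finset.sum_sub_distrib, Finset.sum_const, ← Finset.mul_sum,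
    Finset.sum_boole, Finset.card_univ, Fintype.card_fin, nsmul_eq_mul]
  set d := (1 - 2 * p) ^ 2 with hd
  set a := (1 - p) ^ 2 + p ^ 2 with ha
  have hd0 : 0 ≤ d := sq_nonneg _
  have hd1 : d ≤ 1 := by rw [hd]; nlinarith
  have ha1 : a ≤ 1 := by rw [ha]; nlinarith
  have hda : d ≤ a := by rw [hd, ha]; nlinarith
  have hδd : δ * d ≤ 1 := mul_le_one₀ hδ1 hd0 hd1
  have hδd0 : 0 ≤ δ * d := mul_nonneg hδ0 hd0
  set N := (n : ℝ) * q ^ 2 with hN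
  have hN0 : 0 ≤ N := by positivity
  rcases hl with ⟨rfl, hX⟩ | ⟨rfl, hX⟩
  · have he := exp_sub_one_le (l := -(δ * d / 4)) (by rw [abs_neg, abs_of_nonneg] <;> linarith)
    have hc : (Finset.univ.filter fun j => X i j ≠ X 0 j).card = 0 := by
      simp [hX]
    have hna : (n : ℝ) * (q ^ 2 * a) = N * a := by rw [hN]; ring
    rw [hc, Nat.cast_zero, mul_zero, sub_zero, hna]
    have hNa : 0 ≤ N * a := mul_nonneg hN0 (by linarith)
    have h2 := mul_le_mul_of_nonneg_right he hNa
    have h3 : N * a * (δ * d) ^ 2 ≤ N * (δ * d) ^ 2 :=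
      mul_le_mul_of_nonneg_right (mul_le_of_le_one_right hN0 ha1) (sq_nonneg _)
    nlinarith
  · have he := exp_sub_one_le (l := δ * d / 4) (by rw [abs_of_nonneg] <;> linarith)
    have hexp : 0 ≤ Real.exp (δ * d / 4) - 1 := by
      have := Real.add_one_le_exp (δ * d / 4)
      linarith
    have hm : (n : ℝ) * (q ^ 2 * a) - q ^ 2 * d *
        (Finset.univ.filter fun j => X i j ≠ X 0 j).card ≤ N * (a - δ * d) := by
      have := mul_le_mul_of_nonneg_left hX (mul_nonneg (sq_nonneg q) hd0)
      rw [hN]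
      nlinarith
    have hNa : 0 ≤ N * (a - δ * d) := mul_nonneg hN0 (by nlinarith)
    have h2 := (mul_le_mul_of_nonneg_left hm hexp).trans (mul_le_mul_of_nonneg_right he hNa)
    have h3 : N * (a - δ * d) * (δ * d) ^ 2 ≤ N * (δ * d) ^ 2 :=
      mul_le_mul_of_nonneg_right (mul_le_of_le_one_right hN0 (by linarith)) (sq_nonneg _)
    nlinarith

/-- The selected rows have the same ratings as the first row, with high probability. -/
theorem Pr_exists_isTop_le {p q : ℝ} (hp0 : 0 ≤ p) (hp : p < 1 / 2) (hq0 : 0 ≤ q) (hq1 : q ≤ 1)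
    (X : Fin n → Fin n → Bool) {δ : ℝ} (hδ0 : 0 < δ) (hδ1 : δ ≤ 1) (hT : 2 ≤ T)
    (hG : T ≤ (Finset.univ.filter fun i => ∀ j, X i j = X 0 j).card)
    (hX : ∀ i, (∃ j, X i j ≠ X 0 j) →
      δ * n ≤ (Finset.univ.filter fun j => X i j ≠ X 0 j).card) :
    Pr (fun c : Fin n × Fin n => cellWeight p q (X c.1 c.2))
      {y | ∃ S, IsTop T (similarity (fun i j => y (i, j)) 0) S ∧
        ∃ i ∈ S, i ∉ {i | ∀ j, X i j = X 0 j}} ≤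
      n * Real.exp (-(n * q ^ 2 * (δ * (1 - 2 * p) ^ 2) ^ 2 / 16)) := by
  have hw := isWeight_cell hp0 (by linarith) hq0 hq1 X
  set τ := n * q ^ 2 * ((1 - p) ^ 2 + p ^ 2 - δ * (1 - 2 * p) ^ 2 / 2) with hτ
  set E : Fin n → Set (Fin n × Fin n → Option Bool) := fun i =>
    {y | i ≠ 0 ∧ (((∀ j, X i j = X 0 j) ∧ (similarity (fun i j => y (i, j)) 0 i : ℝ) ≤ τ) ∨
      ((∃ j, X i j ≠ X 0 j) ∧ τ ≤ similarity (fun i j => y (i, j)) 0 i))} with hE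
  have hsub : {y | ∃ S, IsTop T (similarity (fun i j => y (i, j)) 0) S ∧
        ∃ i ∈ S, i ∉ {i | ∀ j, X i j = X 0 j}} ⊆ ⋃ i, E i := by
    rintro y ⟨S, hS, l, hl, hlG⟩
    by_contra hy
    rw [Set.mem_iUnion, not_exists] at hy
    have := subset_of_isTop (τ := τ) hT hG (similarity_le_self _) ?_ ?_ hS l hl
    · exact hlG (by simpa using this)
    · intro i hi hi0
      by_contra hcon
      exact hy i ⟨hi0, Or.inl ⟨by simpa using hi, not_lt.1 hcon⟩⟩
    · intro i hi
      by_contra hcon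
      have hi' : ∃ j, X i j ≠ X 0 j := by simpa using hi
      refine hy i ⟨?_, Or.inr ⟨hi', not_lt.1 hcon⟩⟩
      rintro rfl
      simp at hi'
  refine (Pr_mono hw hsub).trans ((Pr_iUnion_le hw E).trans ?_)
  have hd : 0 < (1 - 2 * p) ^ 2 := by
    have : 0 < 1 - 2 * p := by linarith
    positivity
  have hone : ∀ i, Pr (fun c : Fin n × Fin n => cellWeight p q (X c.1 c.2)) (E i) ≤
      Real.exp (-(n * q ^ 2 * (δ * (1 - 2 * p) ^ 2) ^ 2 / 16)) := by
    intro i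
    by_cases hi : i = 0
    · have : E i = ∅ := by
        ext y
        simp [hE, hi]
      rw [this]
      simp only [Pr, Set.indicator_empty]
      rw [Ex_const hw]
      positivity
    by_cases hXi : ∀ j, X i j = X 0 j
    · refine Pr_similarity_le hp0 (by linarith) hq0 hq1 X hδ0.le hδ1 hi (Or.inl ⟨rfl, hXi⟩) ?_
      rintro y ⟨_, h | h⟩
      · exact mul_le_mul_of_nonpos_left h.2 (by nlinarith)
      · exact absurd hXi (by simpa using h.1)
    · refine Pr_similarity_le hp0 (by linarith) hq0 hq1 X hδ0.le hδ1 hi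
        (Or.inr ⟨rfl, hX i (by simpa using hXi)⟩) ?_
      rintro y ⟨_, h | h⟩
      · exact absurd h.1 hXi
      · exact mul_le_mul_of_nonneg_left h.2 (by positivity)
  refine (Finset.sum_le_sum fun i _ => hone i).trans_eq ?_
  rw [Finset.sum_const, Finset.card_univ, Fintype.card_fin, nsmul_eq_mul]

/-- Many of the columns with rating `true` in the first row are unobserved for the first user. -/
theorem Pr_card_unobserved_lt_le {p q : ℝ} (hp0 : 0 ≤ p) (hp1 : p ≤ 1) (hq0 : 0 ≤ q) (hq1 : q ≤ 1)
    (X : Fin n → Fin n → Bool) :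
    Pr (fun c : Fin n × Fin n => cellWeight p q (X c.1 c.2))
      {y | ((Finset.univ.filter fun j => X 0 j = true ∧ y (0, j) = none).card : ℝ) <
        (1 - q) * (Finset.univ.filter fun j => X 0 j = true).card / 4} ≤
      Real.exp (-((1 - q) * (Finset.univ.filter fun j => X 0 j = true).card / 8)) := by
  have hw := isWeight_cell hp0 hp1 hq0 hq1 X
  refine (Pr_le_exp_mul_Ex hw
    (fun y => ((Finset.univ.filter fun j => X 0 j = true ∧ y (0, j) = none).card : ℝ)) (-(1 / 2))
    ((1 - q) * (Finset.univ.filter fun j => X 0 j = true).card / 4) fun y hy => ?_).trans ?_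
  · exact mul_le_mul_of_nonpos_left (le_of_lt hy) (by norm_num)
  have h1 := Ex_exp_count_row_le hw 0 (-(1 / 2)) (fun j b => X 0 j = true ∧ b = none)
    (fun j => (1 - q) * if X 0 j = true then 1 else 0) (fun j => by
      rw [Fintype.sum_option]
      by_cases h : X 0 j = true <;> simp [cellWeight, h])
  refine (mul_le_mul_of_nonneg_left h1 (Real.exp_pos _).le).trans ?_
  rw [← Real.exp_add, Real.exp_le_exp, ← Finset.mul_sum, Finset.sum_boole]
  have he := exp_sub_one_le (l := -(1 / 2)) (by norm_num)
  have hM : 0 ≤ (1 - q) * ((Finset.univ.filter fun j => X 0 j = true).card : ℝ) :=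
    mul_nonneg (by linarith) (by positivity)
  have := mul_le_mul_of_nonneg_right he hM
  nlinarith

end Separation

/-! ### The error bound for given ratings. -/

section FixedRatings

/-- The error of the algorithm for a rating matrix whose rows either agree with the first one or
differ from it in many columns. -/
theorem exists_Ex_errorOf_le {p Q δ η : ℝ} (hp0 : 0 ≤ p) (hp : p < 1 / 2) (hQ : Q < 1)
    (hδ0 : 0 < δ) (hδ1 : δ ≤ 1) (hη0 : 0 < η) (hη1 : η < 1) :
    ∃ D M : ℕ, ∃ κ > 0, ∀ (n k : ℕ) [NeZero n] (τ : TopRule n k) (q : ℝ)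
      (X : Fin n → Fin n → Bool), M ≤ k → 0 < q → q ≤ Q →
      k ≤ (Finset.univ.filter fun i => ∀ j, X i j = X 0 j).card →
      (∀ i, (∃ j, X i j ≠ X 0 j) → δ * n ≤ (Finset.univ.filter fun j => X i j ≠ X 0 j).card) →
      δ * n ≤ (Finset.univ.filter fun j => X 0 j = true).card →
      Ex (fun c : Fin n × Fin n => cellWeight p q (X c.1 c.2))
        (fun y => errorOf τ (X 0) fun i j => y (i, j)) ≤
      n * Real.exp (-(n * q ^ 2 * (δ * (1 - 2 * p) ^ 2) ^ 2 / 16)) +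
      Real.exp (-((1 - Q) * δ / 8 * n)) +
      (2 * η + Real.exp (-((1 - Q) * δ / 4 * n * (κ * min ((k - 1) * q * (1 - p)) 1 ^ (D + 1))))) := by
  have hpp : 0 < 1 - p := by linarith
  have hQ' : 0 < 1 - Q := by linarith
  have hρ0 : 0 ≤ p / (1 - p) := by positivity
  have hρ1 : p / (1 - p) < 1 := by rw [div_lt_one hpp]; linarith
  -- There are at most `n` columns with rating 0 and at least (1-Q)δn/4 unobserved ones with rating
  -- 1, so this `D`, independent of `n`, makes the exchange term at most η.
  obtain ⟨D, hD⟩ := exists_pow_lt_of_lt_one (y := p / (1 - p))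
    (show 0 < η * ((1 - Q) * δ / 4) by positivity) hρ1
  obtain ⟨M, κ, hκ, hgap⟩ := exists_binomTail_gap hη0 hη1 D hQ
  -- The extra 2 pays for erasing row 0 from the selection and ensures k ≥ 2 for the separation of
  -- scores.
  refine ⟨D, M + 2, κ, hκ, fun n k _ τ q X hk hq0 hqQ hG hX hone => ?_⟩
  have hq1 : q ≤ 1 := by linarith
  have hn0 : (0 : ℝ) < n := by exact_mod_cast Nat.pos_of_ne_zero (NeZero.ne n)
  have hw := isWeight_cell hp0 (by linarith) hq0.le hq1 X
  set ν := (1 - q) * (Finset.univ.filter fun j => X 0 j = true).card / 4 with hν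
  have hνδ : (1 - Q) * δ / 4 * n ≤ ν := by
    have h1 : (1 - Q) * (δ * n) ≤ (1 - q) * (Finset.univ.filter fun j => X 0 j = true).card :=
      mul_le_mul (by linarith) hone (by positivity) (by linarith)
    rw [hν]
    linarith
  have hδn : 0 < (1 - Q) * δ / 4 * n := by positivity
  have hν0 : 0 < ν := by linarith
  have h1 := Pr_exists_isTop_le hp0 hp hq0.le hq1 X hδ0 hδ1 (by omega) hG hX
  have h2 := Pr_card_unobserved_lt_le hp0 (by linarith) hq0.le hq1 X
  refine (Ex_errorOf_le hw τ (X 0) {i | ∀ j, X i j = X 0 j} (ν := ν)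
    (η := 2 * η + Real.exp (-((1 - Q) * δ / 4 * n *
      (κ * min ((k - 1) * q * (1 - p)) 1 ^ (D + 1))))) hν0 (by positivity) ?_).trans
    (add_le_add_left (add_le_add h1 (h2.trans ?_)) _)
  · intro S hSk hSG u hu
    have hm1 : k ≤ (S.erase 0).card + 1 := by
      have := Finset.pred_card_le_card_erase (s := S) (a := 0)
      omega
    have hs0 : 0 < q * (1 - p) := by positivity
    obtain ⟨t, ht1, ht2⟩ := hgap (S.erase 0).card (by omega) (q * (1 - p)) hs0 (by nlinarith)
    have hmain := card_mul_Ex_falseFraction_cell_le hp0 hp hq0.le hq1 X (X 0) (S.erase 0) u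
      (fun i hi j _ => hSG i (Finset.mem_of_mem_erase hi) j) t D
    set O : ℝ := ((u.filter fun j => X 0 j = true).card : ℝ) with hO
    set b := binomTail (S.erase 0).card (q * (1 - p)) (t + D) with hb
    have hO0 : 0 < O := hν0.trans_le hu
    have hZ : ((u.filter fun j => X 0 j = false).card : ℝ) ≤ n := by
      have := Finset.card_le_univ (u.filter fun j => X 0 j = false)
      rw [Fintype.card_fin] at this
      exact_mod_cast this
    have hmin : min ((k - 1) * q * (1 - p)) 1 ≤ min ((S.erase 0).card * (q * (1 - p))) 1 := by
      refine min_le_min_right _ ?_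
      rw [mul_assoc]
      refine mul_le_mul_of_nonneg_right ?_ hs0.le
      rw [sub_le_iff_le_add]
      exact_mod_cast hm1
    have hk1 : 0 ≤ ((k : ℝ) - 1) * q * (1 - p) := by
      have : (1 : ℝ) ≤ k := by exact_mod_cast (by omega : 1 ≤ k)
      have : 0 ≤ (k : ℝ) - 1 := by linarith
      positivity
    have hκb : κ * min ((k - 1) * q * (1 - p)) 1 ^ (D + 1) ≤ b :=
      (mul_le_mul_of_nonneg_left (pow_le_pow_left₀ (le_min hk1 zero_le_one) hmin _)
        hκ.le).trans ht2
    have hκ0 : 0 ≤ κ * min ((k - 1) * q * (1 - p)) 1 ^ (D + 1) :=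
      mul_nonneg hκ.le (pow_nonneg (le_min hk1 zero_le_one) _)
    have hb1 : b ≤ 1 := by
      rw [hb, binomTail]
      refine le_of_le_of_eq ?_ (sum_binom (S.erase 0).card (q * (1 - p)))
      refine Finset.sum_le_sum fun w _ => ?_
      have := binom_nonneg hs0.le (by nlinarith : q * (1 - p) ≤ 1) (S.erase 0).card w
      split_ifs <;> linarith
    have hpow : (1 - b) ^ (u.filter fun j => X 0 j = true).card ≤
        Real.exp (-((1 - Q) * δ / 4 * n *
          (κ * min ((k - 1) * q * (1 - p)) 1 ^ (D + 1)))) := by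
      have h3 : 1 - b ≤ Real.exp (-b) := by
        have := Real.add_one_le_exp (-b)
        linarith
      refine (pow_le_pow_left₀ (by linarith) h3 _).trans ?_
      rw [← Real.exp_nat_mul, Real.exp_le_exp, mul_neg, neg_le_neg_iff]
      exact mul_le_mul (hνδ.trans hu) hκb hκ0 hO0.le
    have hZρ : ((u.filter fun j => X 0 j = false).card : ℝ) * (p / (1 - p)) ^ D ≤ O * η := by
      calc _ ≤ (n : ℝ) * (η * ((1 - Q) * δ / 4)) :=
            mul_le_mul hZ hD.le (by positivity) hn0.le
        _ = (1 - Q) * δ / 4 * n * η := by ring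
        _ ≤ O * η := mul_le_mul_of_nonneg_right (hνδ.trans hu) hη0.le
    refine le_of_mul_le_mul_left (hmain.trans ?_) hO0
    have h4 := mul_le_mul_of_nonneg_left (add_le_add ht1 hpow) hO0.le
    linarith
  · rw [Real.exp_le_exp, neg_le_neg_iff]
    have h3 : (1 - q) * (Finset.univ.filter fun j => X 0 j = true).card / 8 = ν / 2 := by
      rw [hν]; ring
    rw [h3]
    linarith

end FixedRatings

/-! ### The model as a mixture over cluster ratings. -/

section Law

/-- The weights of a random bit that is `true` with probability `p`. -/
def bitWeight (p : ℝ) (b : Bool) : ℝ := if b then p else 1 - p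

theorem isWeight_bit {ι : Type*} {p : ℝ} (h0 : 0 ≤ p) (h1 : p ≤ 1) :
    IsWeight fun _ : ι => bitWeight p where
  nonneg i b := by
    unfold bitWeight
    split_ifs <;> linarith
  sum_eq_one i := by simp [bitWeight]

theorem pi_bernoulliMeasure_real_singleton {ι : Type*} [Fintype ι] (p : unitInterval)
    (x : ι → Bool) :
    (Measure.pi fun _ : ι => bernoulliMeasure true false p).real {x} =
      ∏ i, bitWeight p (x i) := by
  rw [measureReal_def, Measure.pi_singleton, ENNReal.toReal_prod]
  refine Finset.prod_congr rfl fun i _ => ?_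
  rw [← measureReal_def, bernoulliMeasure_real_apply p (MeasurableSet.singleton _)]
  cases x i <;> simp [bitWeight]

theorem integral_law (n r : ℕ) (p ε : unitInterval) (g : Sample n r → ℝ) :
    ∫ ω, g ω ∂(law n r p ε) = Ex (fun _ : Fin r × Fin r => bitWeight (half : ℝ)) fun χ =>
      Ex (fun _ : Fin n × Fin n => bitWeight p) fun F =>
        Ex (fun _ : Fin n × Fin n => bitWeight ε) fun E => g (χ, F, E) := by
  have : IsFiniteMeasure (law n r p ε) := by unfold law; infer_instance
  rw [integral_fintype (Integrable.of_finite), Fintype.sum_prod_type]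
  unfold Ex
  refine Finset.sum_congr rfl fun χ _ => ?_
  rw [Fintype.sum_prod_type, Finset.mul_sum]
  refine Finset.sum_congr rfl fun F _ => ?_
  rw [Finset.mul_sum, Finset.mul_sum]
  refine Finset.sum_congr rfl fun E _ => ?_
  rw [← Set.singleton_prod_singleton, ← Set.singleton_prod_singleton, law, measureReal_prod_prod,
    measureReal_prod_prod, pi_bernoulliMeasure_real_singleton, pi_bernoulliMeasure_real_singleton,
    pi_bernoulliMeasure_real_singleton, smul_eq_mul]
  ring

/-- Flipping and erasing act entry by entry, so it is enough to compare the two sides on products of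
indicators of entries. -/
theorem Ex_flip_erase {ι : Type*} [Fintype ι] [DecidableEq ι] (p ε : ℝ) (x : ι → Bool)
    (h : (ι → Option Bool) → ℝ) :
    Ex (fun _ : ι => bitWeight p) (fun F => Ex (fun _ : ι => bitWeight ε) fun E =>
      h fun c => if E c = true then none else some (xor (x c) (F c))) =
      Ex (fun c => cellWeight p (1 - ε) (x c)) h := by
  have e : h = fun y => ∑ z, h z * ∏ i, if y i = z i then (1 : ℝ) else 0 :=
    funext fun y => sum_mul_prod_ite h y
  rw [e]
  simp only [Ex_sum, Ex_mul_left]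
  refine Finset.sum_congr rfl fun z _ => congrArg _ ?_
  have h1 : ∀ F : ι → Bool, Ex (fun _ : ι => bitWeight ε) (fun E => ∏ c,
      if (if E c = true then none else some (xor (x c) (F c))) = z c then (1 : ℝ) else 0) =
      ∏ c, ∑ b, bitWeight ε b *
        if (if b = true then none else some (xor (x c) (F c))) = z c then (1 : ℝ) else 0 :=
    fun F => Ex_prod (fun _ : ι => bitWeight ε) fun c b =>
      if (if b = true then none else some (xor (x c) (F c))) = z c then (1 : ℝ) else 0
  simp only [h1]
  rw [Ex_prod (fun _ : ι => bitWeight p) (fun c a => ∑ b, bitWeight ε b *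
      if (if b = true then none else some (xor (x c) a)) = z c then (1 : ℝ) else 0),
    Ex_prod _ (fun c b => if b = z c then (1 : ℝ) else 0)]
  refine Finset.prod_congr rfl fun c _ => ?_
  rcases z c with _ | _ | _ <;> cases x c <;>
    simp [bitWeight, cellWeight] <;> ring

theorem integral_errorGiven_mul {n r k T : ℕ} [NeZero n] (C : Clustering n r k) (τ : TopRule n T)
    (p ε : unitInterval) (g : (Fin r × Fin r → Bool) → ℝ) :
    ∫ ω, g ω.1 * errorGiven C τ ω ∂(law n r p ε) =
      Ex (fun _ : Fin r × Fin r => bitWeight (half : ℝ)) fun χ => g χ *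
        Ex (fun c : Fin n × Fin n => cellWeight p (1 - ε) (χ (C.row c.1, C.col c.2))) fun y =>
          errorOf τ (fun j => χ (C.row 0, C.col j)) fun i j => y (i, j) := by
  rw [integral_law]
  refine congrArg _ (funext fun χ => ?_)
  simp only [Ex_mul_left]
  rw [← Ex_flip_erase]
  rfl

end Law

/-! ### Typical cluster ratings. -/

section Ratings

variable {r : ℕ}

theorem half_coe : (half : ℝ) = 1 / 2 := rfl

theorem isWeight_half {ι : Type*} : IsWeight fun _ : ι => bitWeight (half : ℝ) :=
  isWeight_bit (by norm_num [half_coe]) (by norm_num [half_coe])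

theorem chernoff_half (N : ℝ) (h : (Fin r × Fin r → Bool) → ℝ) {E : Set (Fin r × Fin r → Bool)}
    (hE : ∀ χ ∈ E, h χ ≤ N / 8)
    (hexp : Ex (fun _ : Fin r × Fin r => bitWeight (half : ℝ))
      (fun χ => Real.exp (-(1 / 2) * h χ)) ≤ Real.exp ((Real.exp (-(1 / 2)) - 1) * (N / 2)))
    (hN : 0 ≤ N) :
    Pr (fun _ : Fin r × Fin r => bitWeight (half : ℝ)) E ≤ Real.exp (-(N / 16)) := by
  refine (Pr_le_exp_mul_Ex isWeight_half h (-(1 / 2)) (N / 8) fun χ hχ =>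
    mul_le_mul_of_nonpos_left (hE χ hχ) (by norm_num)).trans ?_
  refine (mul_le_mul_of_nonneg_left hexp (Real.exp_pos _).le).trans ?_
  rw [← Real.exp_add, Real.exp_le_exp]
  have := mul_le_mul_of_nonneg_right (exp_sub_one_le (l := -(1 / 2)) (by norm_num))
    (show 0 ≤ N / 2 by positivity)
  linarith

theorem Pr_card_true_le (a : Fin r) :
    Pr (fun _ : Fin r × Fin r => bitWeight (half : ℝ))
      {χ | ((Finset.univ.filter fun b => χ (a, b) = true).card : ℝ) ≤ r / 8} ≤
      Real.exp (-((r : ℝ) / 16)) := by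
  refine chernoff_half r (fun χ => ((Finset.univ.filter fun b => χ (a, b) = true).card : ℝ))
    (fun χ hχ => hχ) ?_ (by positivity)
  refine (Ex_exp_count_row_le isWeight_half a (-(1 / 2)) (fun _ b => b = true) (fun _ => 1 / 2)
    fun j => ?_).trans_eq ?_
  · simp [bitWeight, half_coe]
  · simp [div_eq_mul_inv]

theorem Pr_card_ne_le {a a' : Fin r} (haa : a ≠ a') :
    Pr (fun _ : Fin r × Fin r => bitWeight (half : ℝ))
      {χ | ((Finset.univ.filter fun b => χ (a, b) ≠ χ (a', b)).card : ℝ) ≤ r / 8} ≤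
      Real.exp (-((r : ℝ) / 16)) := by
  refine chernoff_half r (fun χ => ((Finset.univ.filter fun b => χ (a, b) ≠ χ (a', b)).card : ℝ))
    (fun χ hχ => hχ) ?_ (by positivity)
  refine (Ex_exp_count_two_rows_le isWeight_half haa (-(1 / 2)) (fun _ b b' => b ≠ b')
    (fun _ => 1 / 2) fun j => ?_).trans_eq ?_
  · simp [bitWeight, half_coe]; norm_num
  · simp [div_eq_mul_inv]

/-- The cluster ratings for which every row of clusters agrees with the row `a₀` or differs from it
in a proportion `δ` of the entries, and row `a₀` vanishes or has a proportion `δ` of ones. -/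
def separated (δ : ℝ) (a₀ : Fin r) : Set (Fin r × Fin r → Bool) :=
  {χ | ((∃ b, χ (a₀, b) = true) →
      δ * r ≤ (Finset.univ.filter fun b => χ (a₀, b) = true).card) ∧
    ∀ a, (∃ b, χ (a, b) ≠ χ (a₀, b)) →
      δ * r ≤ (Finset.univ.filter fun b => χ (a, b) ≠ χ (a₀, b)).card}

/-- One δ must serve all `r`, because `r` may stay bounded. For large `r`, Chernoff and a union
bound give proportion 1/8; for small `r`, a nonempty set of labels already has proportion at least
1/r. -/
theorem exists_Pr_separated_compl_le {η : ℝ} (hη : 0 < η) :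
    ∃ δ : ℝ, 0 < δ ∧ δ ≤ 1 ∧ ∀ (r : ℕ) (a₀ : Fin r),
      Pr (fun _ : Fin r × Fin r => bitWeight (half : ℝ)) (separated δ a₀)ᶜ ≤ η := by
  have hlim : Tendsto (fun r : ℕ => ((r : ℝ) + 1) * Real.exp (-((r : ℝ) / 16))) atTop (𝓝 0) := by
    have h1 : Tendsto (fun x : ℝ => 16 * (x ^ 1 * Real.exp (-x)) + Real.exp (-x)) atTop
        (𝓝 (16 * 0 + 0)) :=
      ((Real.tendsto_pow_mul_exp_neg_atTop_nhds_zero 1).const_mul 16).add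
        Real.tendsto_exp_neg_atTop_nhds_zero
    have h2 : Tendsto (fun r : ℕ => (r : ℝ) / 16) atTop atTop :=
      tendsto_natCast_atTop_atTop.atTop_div_const (by norm_num)
    have h3 := h1.comp h2
    rw [mul_zero, add_zero] at h3
    refine h3.congr fun r => ?_
    simp only [Function.comp_apply]
    ring
  obtain ⟨R, hR⟩ := eventually_atTop.1 (hlim.eventually_le_const hη)
  -- Below 1/8 for the Chernoff range, and δr ≤ 1 for r < R.
  refine ⟨1 / (R + 8), by positivity, ?_, fun r a₀ => ?_⟩
  · rw [div_le_one (by positivity)]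
    have : (0 : ℝ) ≤ R := Nat.cast_nonneg R
    linarith
  by_cases hr : R ≤ r
  · refine le_trans ?_ (hR r hr)
    have hδ8 : (1 : ℝ) / (R + 8) * r ≤ r / 8 := by
      rw [one_div, inv_mul_eq_div]
      exact div_le_div_of_nonneg_left (by positivity) (by norm_num)
        (by linarith [(Nat.cast_nonneg R : (0 : ℝ) ≤ R)])
    set E : Fin r → Set (Fin r × Fin r → Bool) := fun a =>
      {χ | a ≠ a₀ ∧ ((Finset.univ.filter fun b => χ (a, b) ≠ χ (a₀, b)).card : ℝ) ≤ r / 8} with hE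
    have hsub : (separated ((1 : ℝ) / (R + 8)) a₀)ᶜ ⊆ (⋃ a, E a) ∪
        {χ | ((Finset.univ.filter fun b => χ (a₀, b) = true).card : ℝ) ≤ r / 8} := by
      intro χ hχ
      by_contra hcon
      rw [Set.mem_union, not_or, Set.mem_iUnion, not_exists] at hcon
      refine hχ ⟨fun _ => hδ8.trans (not_le.1 hcon.2).le, fun a ⟨b, hb⟩ => ?_⟩
      by_contra hlt
      refine hcon.1 a ⟨fun h => hb (by rw [h]), ((not_le.1 hlt).le.trans hδ8)⟩
    refine (Pr_mono isWeight_half hsub).trans ((Pr_union_le isWeight_half _ _).trans ?_)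
    rw [add_one_mul]
    refine add_le_add ((Pr_iUnion_le isWeight_half E).trans ?_) (Pr_card_true_le a₀)
    have hone : ∀ a, Pr (fun _ : Fin r × Fin r => bitWeight (half : ℝ)) (E a) ≤
        Real.exp (-((r : ℝ) / 16)) := by
      intro a
      by_cases ha : a = a₀
      · have : E a = ∅ := by
          ext y
          simp [hE, ha]
        rw [this]
        simp only [Pr, Set.indicator_empty]
        rw [Ex_const isWeight_half]
        positivity
      · exact (Pr_mono isWeight_half fun χ hχ => hχ.2).trans (Pr_card_ne_le ha)
    refine (Finset.sum_le_sum fun a _ => hone a).trans_eq ?_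
    rw [Finset.sum_const, Finset.card_univ, Fintype.card_fin, nsmul_eq_mul]
  · have hδ1 : (1 : ℝ) / (R + 8) * r ≤ 1 := by
      rw [one_div, inv_mul_eq_div, div_le_one (by positivity)]
      have : (r : ℝ) ≤ R := by exact_mod_cast (not_le.1 hr).le
      linarith
    have : (separated ((1 : ℝ) / (R + 8)) a₀)ᶜ = ∅ := by
      rw [Set.compl_empty_iff, Set.eq_univ_iff_forall]
      refine fun χ => ⟨fun ⟨b, hb⟩ => hδ1.trans ?_, fun a ⟨b, hb⟩ => hδ1.trans ?_⟩
      · exact_mod_cast Finset.card_pos.2 ⟨b, by simpa using hb⟩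
      · exact_mod_cast Finset.card_pos.2 ⟨b, by simpa using hb⟩
    rw [this]
    simp only [Pr, Set.indicator_empty]
    rw [Ex_const isWeight_half]
    exact hη.le

theorem Pr_row_eq_false (a : Fin r) :
    Pr (fun _ : Fin r × Fin r => bitWeight (half : ℝ)) {χ | ∀ b, χ (a, b) = false} =
      (1 / 2) ^ r := by
  have := Ex_prod_row (w := fun _ : Fin r × Fin r => bitWeight (half : ℝ)) isWeight_half a
    (fun _ b => if b = false then 1 else 0)
  have h : ∏ j : Fin r, ∑ b, bitWeight (half : ℝ) b * (if b = false then 1 else 0) =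
      ((1 : ℝ) / 2) ^ r := by
    have h1 : ∑ b, bitWeight (half : ℝ) b * (if b = false then 1 else 0) = 1 / 2 := by
      norm_num [bitWeight, half_coe]
    simp only [h1, Finset.prod_const, Finset.card_univ, Fintype.card_fin]
  rw [← h, ← this]
  unfold Pr
  refine congrArg _ (funext fun χ => ?_)
  rw [Finset.prod_ite_zero]
  simp [Set.indicator_apply]

end Ratings

/-! ### Reduction to the error on a nonzero first row. -/

section Clusters

/-- Since all blocks have the same size, proportions of cluster labels carry over to proportions of
items. -/
theorem card_filter_label {n r k : ℕ} (f : Fin n → Fin r)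
    (hf : ∀ b, (Finset.univ.filter fun j => f j = b).card = k) (P : Fin r → Prop)
    [DecidablePred P] :
    (Finset.univ.filter fun j => P (f j)).card = (Finset.univ.filter P).card * k := by
  rw [Finset.card_eq_sum_card_fiberwise (f := f) (t := Finset.univ.filter P) (by
    intro j hj
    simpa using hj), ← smul_eq_mul, ← Finset.sum_const]
  refine Finset.sum_congr rfl fun b hb => ?_
  rw [← hf b, Finset.filter_filter]
  congr 1
  refine Finset.filter_congr fun j _ => ?_
  simp only [Finset.mem_filter, Finset.mem_univ, true_and] at hb
  exact ⟨fun h => h.2, fun h => ⟨by rw [h]; exact hb, h⟩⟩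

theorem Clustering.card_eq {n r k : ℕ} (C : Clustering n r k) : n = r * k := by
  have := card_filter_label C.col C.card_col fun _ => True
  simpa using this

variable {n r k : ℕ} [NeZero n]

/-- The cluster ratings for which the first user has some rating `true`. -/
def nonzeroRatings (C : Clustering n r k) : Set (Fin r × Fin r → Bool) :=
  {χ | ∃ j, χ (C.row 0, C.col j) = true}

theorem law_real_fst (n r : ℕ) (p ε : unitInterval) (B : Set (Fin r × Fin r → Bool)) :
    (law n r p ε).real {ω | ω.1 ∈ B} =
      Pr (fun _ : Fin r × Fin r => bitWeight (half : ℝ)) B := by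
  rw [← integral_indicator_one (Set.toFinite _).measurableSet, integral_law]
  unfold Pr
  refine congrArg _ (funext fun χ => ?_)
  have h : ∀ F E, ({ω : Sample n r | ω.1 ∈ B}.indicator 1 (χ, F, E) : ℝ) = B.indicator 1 χ :=
    fun F E => rfl
  simp only [h]
  rw [Ex_const (isWeight_bit ε.2.1 ε.2.2), Ex_const (isWeight_bit p.2.1 p.2.2)]

theorem Pr_nonzeroRatings_compl (C : Clustering n r k) :
    Pr (fun _ : Fin r × Fin r => bitWeight (half : ℝ)) (nonzeroRatings C)ᶜ = (1 / 2) ^ r := by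
  rw [← Pr_row_eq_false (C.row 0)]
  congr 1
  ext χ
  simp only [nonzeroRatings, Set.mem_compl_iff, Set.mem_ofPred_eq, not_exists,
    Bool.not_eq_true]
  refine ⟨fun h b => ?_, fun h j => h _⟩
  have hk : 0 < k := by
    have := C.card_eq
    rcases Nat.eq_zero_or_pos k with rfl | hk
    · exact absurd this (by simpa using NeZero.ne n)
    · exact hk
  rw [← C.card_col b, Finset.card_pos] at hk
  obtain ⟨j, hj⟩ := hk
  rw [← (Finset.mem_filter.1 hj).2]
  exact h j

/-- The probability that the first user has some rating `true` and the algorithm fails. -/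
noncomputable def nonzeroError {T : ℕ} (C : Clustering n r k) (τ : TopRule n T) (p ε : unitInterval) : ℝ :=
  ∫ ω, (nonzeroRatings C).indicator 1 ω.1 * errorGiven C τ ω ∂(law n r p ε)

theorem law_firstRowNonzero_compl (C : Clustering n r k) (p ε : unitInterval) :
    (law n r p ε).real (firstRowNonzero C)ᶜ = (1 / 2) ^ r := by
  rw [← Pr_nonzeroRatings_compl C, ← law_real_fst n r p ε]
  rfl

instance (n r : ℕ) (p ε : unitInterval) : IsProbabilityMeasure (law n r p ε) := by
  unfold law; infer_instance

theorem errorGiven_nonneg {T : ℕ} (C : Clustering n r k) (τ : TopRule n T) (ω : Sample n r) :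
    0 ≤ errorGiven C τ ω := errorOf_nonneg τ _ _

theorem errorGiven_le_one {T : ℕ} (C : Clustering n r k) (τ : TopRule n T) (ω : Sample n r) :
    errorGiven C τ ω ≤ 1 := errorOf_le_one τ _ _

theorem errorProb_nonneg {T : ℕ} (C : Clustering n r k) (τ : TopRule n T) (p ε : unitInterval) :
    0 ≤ errorProb C τ p ε :=
  integral_nonneg fun ω => errorGiven_nonneg C τ ω

theorem errorProb_le {T : ℕ} (C : Clustering n r k) (τ : TopRule n T) (p ε : unitInterval) :
    errorProb C τ p ε ≤ nonzeroError C τ p ε + (1 / 2) ^ r := by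
  rw [← law_firstRowNonzero_compl C p ε, ← integral_indicator_one (Set.toFinite _).measurableSet,
    nonzeroError, ← integral_add Integrable.of_finite Integrable.of_finite]
  refine integral_mono Integrable.of_finite Integrable.of_finite fun ω => ?_
  by_cases h : ω ∈ firstRowNonzero C
  · have h' : ω.1 ∈ nonzeroRatings C := h
    simp [h, h']
  · have h' : ω.1 ∉ nonzeroRatings C := h
    simpa [h, h'] using errorGiven_le_one C τ ω

theorem condErrorProb_nonneg {T : ℕ} (C : Clustering n r k) (τ : TopRule n T)
    (p ε : unitInterval) : 0 ≤ condErrorProb C τ p ε :=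
  integral_nonneg fun ω => errorGiven_nonneg C τ ω

/-- The conditioning event has probability 1 - 2^(-r) ≥ 1/2. -/
theorem condErrorProb_le {T : ℕ} (C : Clustering n r k) (τ : TopRule n T) (p ε : unitInterval) :
    condErrorProb C τ p ε ≤ 2 * nonzeroError C τ p ε := by
  have hr : r ≠ 0 := by
    rintro rfl
    exact absurd C.card_eq (by simpa using NeZero.ne n)
  have hm : MeasurableSet (firstRowNonzero C) := (Set.toFinite _).measurableSet
  have hP : 1 / 2 ≤ (law n r p ε).real (firstRowNonzero C) := by
    have h1 := law_firstRowNonzero_compl C p ε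
    rw [probReal_compl_eq_one_sub hm] at h1
    have h2 : ((1 : ℝ) / 2) ^ r ≤ 1 / 2 := pow_le_of_le_one (by norm_num) (by norm_num) hr
    linarith
  have h0 : 0 ≤ nonzeroError C τ p ε := integral_nonneg fun ω =>
    mul_nonneg (Set.indicator_nonneg (by simp) _) (errorGiven_nonneg C τ ω)
  have e : condErrorProb C τ p ε =
      ((law n r p ε).real (firstRowNonzero C))⁻¹ * nonzeroError C τ p ε := by
    unfold condErrorProb nonzeroError ProbabilityTheory.cond
    rw [integral_smul_measure, ENNReal.toReal_inv, ← measureReal_def, smul_eq_mul,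
      ← integral_indicator hm]
    congr 2
    funext ω
    by_cases h : ω ∈ firstRowNonzero C
    · have h' : ω.1 ∈ nonzeroRatings C := h
      simp [h, h']
    · have h' : ω.1 ∉ nonzeroRatings C := h
      simp [h, h']
  rw [e]
  refine mul_le_mul_of_nonneg_right ?_ h0
  rw [inv_le_comm₀ (by linarith) (by norm_num)]
  linarith

theorem nonzeroError_le {T : ℕ} (C : Clustering n r k) (τ : TopRule n T) (p ε : unitInterval)
    {δ B : ℝ} (hB : 0 ≤ B)
    (h : ∀ χ ∈ separated δ (C.row 0), (∃ b, χ (C.row 0, b) = true) →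
      Ex (fun c : Fin n × Fin n => cellWeight p (1 - ε) (χ (C.row c.1, C.col c.2)))
        (fun y => errorOf τ (fun j => χ (C.row 0, C.col j)) fun i j => y (i, j)) ≤ B) :
    nonzeroError C τ p ε ≤
      Pr (fun _ : Fin r × Fin r => bitWeight (half : ℝ)) (separated δ (C.row 0))ᶜ + B := by
  unfold nonzeroError
  rw [integral_errorGiven_mul, ← Ex_const (w := fun _ : Fin r × Fin r => bitWeight (half : ℝ))
    isWeight_half B, Pr, ← Ex_add]
  refine Ex_mono isWeight_half fun χ => ?_
  have hcell := isWeight_cell p.2.1 p.2.2 (q := 1 - ε) (by linarith [ε.2.2]) (by linarith [ε.2.1])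
    (fun i j => χ (C.row i, C.col j))
  have h1 := Ex_le_of_le hcell fun y =>
    errorOf_le_one τ (fun j => χ (C.row 0, C.col j)) fun i j => y (i, j)
  by_cases hχ : χ ∈ nonzeroRatings C
  · rw [Set.indicator_of_mem hχ, Pi.one_apply, one_mul]
    by_cases hs : χ ∈ separated δ (C.row 0)
    · rw [Set.indicator_of_notMem (by simpa using hs), zero_add]
      obtain ⟨j, hj⟩ := hχ
      exact h χ hs ⟨_, hj⟩
    · rw [Set.indicator_of_mem (by simpa using hs), Pi.one_apply]
      linarith
  · rw [Set.indicator_of_notMem hχ, zero_mul]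
    exact add_nonneg (Set.indicator_nonneg (by simp) _) hB

end Clusters

/-! ### Passage to the limit. -/

section Asymptotics

variable {n r k : ℕ → ℕ} [∀ m, NeZero (n m)]

theorem tendsto_mul_exp_neg_rpow {β b : ℝ} (hβ : 0 < β) (hb : 0 < b) :
    Tendsto (fun x : ℝ => x * Real.exp (-(b * x ^ β))) atTop (𝓝 0) := by
  have h := (tendsto_rpow_mul_exp_neg_mul_atTop_nhds_zero (1 / β) b hb).comp
    (tendsto_rpow_atTop hβ)
  refine h.congr' ?_
  filter_upwards [eventually_ge_atTop 0] with x hx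
  simp only [Function.comp_apply]
  rw [← Real.rpow_mul hx, mul_one_div_cancel hβ.ne', Real.rpow_one, neg_mul]

/-- Common core of both regimes of α: `hnq` drives the separation of rows, and `hkq` keeps the
popularities from being too sparse. -/
theorem tendsto_nonzeroError (hn : Tendsto n atTop atTop)
    (C : ∀ m, Clustering (n m) (r m) (k m)) (τ : ∀ m, TopRule (n m) (k m))
    (p : unitInterval) (hp : (p : ℝ) < 1 / 2) (ε : ℕ → unitInterval)
    (hk : Tendsto k atTop atTop) {Q β : ℝ} (hQ : Q < 1) (hεQ : ∀ᶠ m in atTop, 1 - (ε m : ℝ) ≤ Q)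
    (hβ : 0 < β) (hnq : ∀ᶠ m in atTop, (n m : ℝ) ^ β ≤ n m * (1 - (ε m : ℝ)) ^ 2)
    (hkq : ∀ a : ℝ, 0 < a → ∀ᶠ m in atTop, (n m : ℝ) ^ (-a) ≤ k m * (1 - (ε m : ℝ))) :
    Tendsto (fun m => nonzeroError (C m) (τ m) p (ε m)) atTop (𝓝 0) := by
  have hnR : Tendsto (fun m => (n m : ℝ)) atTop atTop := tendsto_natCast_atTop_atTop.comp hn
  have hp0 : (0 : ℝ) ≤ p := p.2.1
  have hpd : 0 < (1 - 2 * (p : ℝ)) ^ 2 := by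
    have : 0 < 1 - 2 * (p : ℝ) := by linarith
    positivity
  have hQ' : 0 < 1 - Q := by linarith
  have h0 : ∀ m, 0 ≤ nonzeroError (C m) (τ m) p (ε m) := fun m => integral_nonneg fun ω =>
    mul_nonneg (Set.indicator_nonneg (by simp) _) (errorGiven_nonneg _ _ ω)
  refine tendsto_order.2 ⟨fun a ha => Eventually.of_forall fun m => ha.trans_le (h0 m),
    fun e he => ?_⟩
  -- The error terms add up to at most 6η < e: one for atypical ratings and five for typical ones.
  set η := min (e / 8) (1 / 2) with hη
  have hη0 : 0 < η := by positivity
  have hη1 : η < 1 := (min_le_right _ _).trans_lt (by norm_num)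
  have hηe : η ≤ e / 8 := min_le_left _ _
  obtain ⟨δ, hδ0, hδ1, hsep⟩ := exists_Pr_separated_compl_le hη0
  obtain ⟨D, M, κ, hκ, hmain⟩ := exists_Ex_errorOf_le hp0 hp hQ hδ0 hδ1 hη0 hη1
  -- Chosen after `D`, so that n · (n^(-a))^(D+1) = n^(1/2) still diverges.
  set a : ℝ := 1 / (2 * (D + 1)) with ha
  have ha0 : 0 < a := by positivity
  have hnat1 : ∀ᶠ m in atTop, (1 : ℝ) ≤ n m := hnR.eventually_ge_atTop 1
  have hlim1 := ((tendsto_mul_exp_neg_rpow hβ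
    (show 0 < (δ * (1 - 2 * (p : ℝ)) ^ 2) ^ 2 / 16 by positivity)).comp hnR).eventually_le_const hη0
  have hlim2 : ∀ᶠ m in atTop, Real.exp (-((1 - Q) * δ / 8 * n m)) ≤ η :=
    (Real.tendsto_exp_neg_atTop_nhds_zero.comp
      (hnR.const_mul_atTop (show 0 < (1 - Q) * δ / 8 by positivity))).eventually_le_const hη0
  have hlim3 : ∀ᶠ m in atTop, Real.exp (-((1 - Q) * δ / 4 * (κ * (1 / 4) ^ (D + 1)) *
      (n m : ℝ) ^ (1 / 2 : ℝ))) ≤ η :=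
    (Real.tendsto_exp_neg_atTop_nhds_zero.comp
      (((tendsto_rpow_atTop (by norm_num : (0 : ℝ) < 1 / 2)).comp hnR).const_mul_atTop
        (show 0 < (1 - Q) * δ / 4 * (κ * (1 / 4) ^ (D + 1)) by positivity))).eventually_le_const hη0
  filter_upwards [hεQ, hnq, hkq a ha0, hk.eventually_ge_atTop (max M 2), hnat1, hlim1, hlim2, hlim3]
    with m hmQ hmnq hmkq hmk hmn hm1 hm2 hm3
  have hn0 : (0 : ℝ) < n m := by linarith
  have hkM : M ≤ k m := (le_max_left _ _).trans hmk
  have hk2 : (2 : ℝ) ≤ k m := by exact_mod_cast (le_max_right _ _).trans hmk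
  have hna : 0 < (n m : ℝ) ^ (-a) := Real.rpow_pos_of_pos hn0 _
  have hq0 : 0 < 1 - (ε m : ℝ) := by
    by_contra hcon
    have : (k m : ℝ) * (1 - (ε m : ℝ)) ≤ 0 :=
      mul_nonpos_of_nonneg_of_nonpos (by linarith) (not_lt.1 hcon)
    linarith
  set q := 1 - (ε m : ℝ) with hq
  have hrk : (n m : ℝ) = r m * k m := by exact_mod_cast (C m).card_eq
  have hB := nonzeroError_le (C m) (τ m) p (ε m) (δ := δ) (B := 5 * η) (by positivity) ?_
  · have := hsep (r m) ((C m).row 0)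
    have h8 : η + 5 * η < e := by linarith
    linarith
  intro χ hχ hne
  refine (hmain (n m) (k m) (τ m) q (fun i j => χ ((C m).row i, (C m).col j)) hkM hq0 hmQ
    ?_ ?_ ?_).trans ?_
  · refine ((C m).card_row ((C m).row 0)).symm.trans_le ?_
    refine Finset.card_le_card fun i hi => ?_
    simp only [Finset.mem_filter, Finset.mem_univ, true_and] at hi ⊢
    exact fun j => by rw [hi]
  · rintro i ⟨j, hj⟩
    rw [card_filter_label (C m).col (C m).card_col fun b =>
      χ ((C m).row i, b) ≠ χ ((C m).row 0, b), Nat.cast_mul, hrk, ← mul_assoc]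
    exact mul_le_mul_of_nonneg_right (hχ.2 _ ⟨_, hj⟩) (by linarith)
  · rw [card_filter_label (C m).col (C m).card_col fun b => χ ((C m).row 0, b) = true,
      Nat.cast_mul, hrk, ← mul_assoc]
    exact mul_le_mul_of_nonneg_right (hχ.1 hne) (by linarith)
  have b1 : n m * Real.exp (-(n m * q ^ 2 * (δ * (1 - 2 * (p : ℝ)) ^ 2) ^ 2 / 16)) ≤ η := by
    refine le_trans ?_ hm1
    simp only [Function.comp_apply]
    refine mul_le_mul_of_nonneg_left ?_ hn0.le
    rw [Real.exp_le_exp, neg_le_neg_iff, mul_div_assoc, mul_comm]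
    exact mul_le_mul_of_nonneg_right hmnq (by positivity)
  have b3 : Real.exp (-((1 - Q) * δ / 4 * n m *
      (κ * min ((k m - 1) * q * (1 - p)) 1 ^ (D + 1)))) ≤ η := by
    refine le_trans ?_ hm3
    rw [Real.exp_le_exp, neg_le_neg_iff]
    have hmin : (1 / 4) * (n m : ℝ) ^ (-a) ≤ min ((k m - 1) * q * (1 - p)) 1 := by
      refine le_min ?_ ?_
      · have h1 : (k m : ℝ) / 2 ≤ k m - 1 := by linarith
        have h2 : (1 : ℝ) / 2 ≤ 1 - p := by linarith
        calc (1 / 4) * (n m : ℝ) ^ (-a) ≤ (1 / 4) * (k m * q) := by gcongr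
          _ = k m / 2 * q * (1 / 2) := by ring
          _ ≤ (k m - 1) * q * (1 - p) :=
            mul_le_mul (mul_le_mul_of_nonneg_right h1 hq0.le) h2 (by norm_num)
              (mul_nonneg (by linarith) hq0.le)
      · have : (n m : ℝ) ^ (-a) ≤ 1 := Real.rpow_le_one_of_one_le_of_nonpos hmn (by linarith)
        linarith
    have hpow := pow_le_pow_left₀ (by positivity) hmin (D + 1)
    have hna2 : ((n m : ℝ) ^ (-a)) ^ (D + 1) * n m = (n m : ℝ) ^ (1 / 2 : ℝ) := by
      rw [← Real.rpow_natCast, ← Real.rpow_mul hn0.le]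
      nth_rewrite 2 [← Real.rpow_one (n m : ℝ)]
      rw [← Real.rpow_add hn0]
      congr 1
      rw [ha]
      push_cast
      field_simp
      norm_num
    rw [mul_pow] at hpow
    calc (1 - Q) * δ / 4 * (κ * (1 / 4) ^ (D + 1)) * (n m : ℝ) ^ (1 / 2 : ℝ)
        = (1 - Q) * δ / 4 * n m * (κ * ((1 / 4) ^ (D + 1) * ((n m : ℝ) ^ (-a)) ^ (D + 1))) := by
          rw [← hna2]; ring
      _ ≤ _ := by gcongr
  linarith

theorem tendsto_condErrorProb {C : ∀ m, Clustering (n m) (r m) (k m)}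
    {τ : ∀ m, TopRule (n m) (k m)} {p : unitInterval} {ε : ℕ → unitInterval}
    (h : Tendsto (fun m => nonzeroError (C m) (τ m) p (ε m)) atTop (𝓝 0)) :
    Tendsto (fun m => condErrorProb (C m) (τ m) p (ε m)) atTop (𝓝 0) := by
  have h2 := h.const_mul 2
  rw [mul_zero] at h2
  exact squeeze_zero (fun m => condErrorProb_nonneg _ _ _ _) (fun m => condErrorProb_le _ _ _ _) h2

/-- From n = rk and k = o(n), the number of clusters tends to infinity, so the first row vanishes
with probability 2^(-r) → 0. -/
theorem tendsto_errorProb {C : ∀ m, Clustering (n m) (r m) (k m)}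
    {τ : ∀ m, TopRule (n m) (k m)} {p : unitInterval} {ε : ℕ → unitInterval}
    (h : Tendsto (fun m => nonzeroError (C m) (τ m) p (ε m)) atTop (𝓝 0))
    (hkn : (fun m => (k m : ℝ)) =o[atTop] fun m => (n m : ℝ)) :
    Tendsto (fun m => errorProb (C m) (τ m) p (ε m)) atTop (𝓝 0) := by
  have hr : Tendsto r atTop atTop := by
    refine tendsto_atTop.2 fun R => ?_
    filter_upwards [hkn.bound (show (0 : ℝ) < 1 / (R + 1) by positivity)] with m hm
    have hrk := (C m).card_eq
    have hk : 0 < k m := by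
      rcases Nat.eq_zero_or_pos (k m) with h0 | h0
      · rw [h0, mul_zero] at hrk
        exact absurd hrk (NeZero.ne _)
      · exact h0
    rw [Real.norm_natCast, Real.norm_natCast, one_div, inv_mul_eq_div,
      le_div_iff₀ (by positivity)] at hm
    have h1 : k m * (R + 1) ≤ n m := by exact_mod_cast hm
    rw [hrk, mul_comm] at h1
    have := Nat.le_of_mul_le_mul_right h1 hk
    omega
  have h2 := h.add ((tendsto_pow_atTop_nhds_zero_of_lt_one (by norm_num : (0 : ℝ) ≤ 1 / 2)
    (by norm_num)).comp hr)
  rw [add_zero] at h2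
  exact squeeze_zero (fun m => errorProb_nonneg _ _ _ _) (fun m => errorProb_le _ _ _ _) h2

end Asymptotics

end PAF

/-! ### The two regimes of α. -/

theorem theorem2
    (n r k : ℕ → ℕ) [∀ m, NeZero (n m)]
    (hn : Tendsto n atTop atTop)
    (C : ∀ m, PAF.Clustering (n m) (r m) (k m))
    (τ : ∀ m, PAF.TopRule (n m) (k m))
    (p : unitInterval) (hp : (p : ℝ) < 1 / 2)
    (c α : ℝ) (hc : 0 < c)
    (ε : ℕ → unitInterval)
    (hε : ∀ᶠ m in atTop, (ε m : ℝ) = 1 - c / (n m : ℝ) ^ α) :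
    (0 < α → α < 1 / 2 →
      ∀ γ : ℕ → ℝ, (∀ m, 0 ≤ γ m) → Tendsto γ atTop (𝓝 0) →
        (∀ᶠ m in atTop, (n m : ℝ) ^ (α - γ m) ≤ (k m : ℝ)) →
        (((fun m => (k m : ℝ)) =o[atTop] fun m => (n m : ℝ)) →
          Tendsto (fun m => PAF.errorProb (C m) (τ m) p (ε m)) atTop (𝓝 0)) ∧
        (((fun m => (k m : ℝ)) =Θ[atTop] fun m => (n m : ℝ)) →
          Tendsto (fun m => PAF.condErrorProb (C m) (τ m) p (ε m)) atTop (𝓝 0))) ∧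
    (α = 0 → c < 1 → Tendsto k atTop atTop →
        (((fun m => (k m : ℝ)) =o[atTop] fun m => (n m : ℝ)) →
          Tendsto (fun m => PAF.errorProb (C m) (τ m) p (ε m)) atTop (𝓝 0)) ∧
        Tendsto (fun m => PAF.condErrorProb (C m) (τ m) p (ε m)) atTop (𝓝 0)) := by

  have hnR : Tendsto (fun m => (n m : ℝ)) atTop atTop := tendsto_natCast_atTop_atTop.comp hn
  have hn1 : ∀ᶠ m in atTop, (1 : ℝ) ≤ n m := hnR.eventually_ge_atTop 1
  constructor
  · intro hα0 hα1 γ hγ0 hγ hkγ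
    have hkey : Tendsto (fun m => PAF.nonzeroError (C m) (τ m) p (ε m)) atTop (𝓝 0) := by
      have hk : Tendsto k atTop atTop := by
        rw [← tendsto_natCast_atTop_iff (R := ℝ)]
        refine tendsto_atTop_mono' atTop ?_ ((tendsto_rpow_atTop (half_pos hα0)).comp hnR)
        filter_upwards [hkγ, hn1, hγ.eventually_le_const (half_pos hα0)] with m h1 h2 h3
        exact (Real.rpow_le_rpow_of_exponent_le h2 (by linarith)).trans h1
      -- Here n q² = c² n^(1-2α), which is where α < 1/2 enters; half of the exponent is given up to
      -- absorb c².
      refine PAF.tendsto_nonzeroError hn C τ p hp ε hk (Q := 1 / 2) (β := (1 - 2 * α) / 2)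
        (by norm_num) ?_ (by linarith) ?_ fun a ha => ?_
      · have hlim := ((tendsto_rpow_neg_atTop hα0).comp hnR).const_mul c
        rw [mul_zero] at hlim
        filter_upwards [hε, hn1, hlim.eventually_le_const (show (0 : ℝ) < 1 / 2 by norm_num)]
          with m h1 h2 h3
        simp only [Function.comp_apply] at h3
        rw [Real.rpow_neg (by linarith), ← div_eq_mul_inv] at h3
        rw [h1]
        linarith
      · have hlim := ((tendsto_rpow_atTop (show 0 < (1 - 2 * α) / 2 by linarith)).comp
          hnR).const_mul_atTop (show 0 < c ^ 2 by positivity)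
        filter_upwards [hε, hn1, hlim.eventually_ge_atTop 1] with m h1 h2 h3
        simp only [Function.comp_apply] at h3
        have hn0 : (0 : ℝ) < n m := by linarith
        have e : (n m : ℝ) * (1 - (ε m : ℝ)) ^ 2 =
            c ^ 2 * (n m : ℝ) ^ ((1 - 2 * α) / 2) * (n m : ℝ) ^ ((1 - 2 * α) / 2) := by
          rw [h1, mul_assoc, ← Real.rpow_add hn0, sub_sub_cancel, div_pow, ← Real.rpow_natCast,
            ← Real.rpow_natCast, ← Real.rpow_mul hn0.le,
            show (1 - 2 * α) / 2 + (1 - 2 * α) / 2 = 1 - α * (2 : ℕ) by push_cast; ring,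
            Real.rpow_sub hn0, Real.rpow_one]
          ring
        rw [e]
        exact le_mul_of_one_le_left (by positivity) h3
      -- The powers n^α cancel: kq ≥ c n^(-γ), and γ → 0 beats any fixed `a`, with room a/2 left to
      -- absorb `c`.
      · have hlim := ((tendsto_rpow_atTop (half_pos ha)).comp hnR).const_mul_atTop hc
        filter_upwards [hε, hn1, hkγ, hγ.eventually_le_const (half_pos ha),
          hlim.eventually_ge_atTop 1] with m h1 h2 h3 h4 h5
        simp only [Function.comp_apply] at h5
        have hn0 : (0 : ℝ) < n m := by linarith
        calc (n m : ℝ) ^ (-a) ≤ c * (n m : ℝ) ^ (a / 2) * (n m : ℝ) ^ (-a) :=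
              le_mul_of_one_le_left (by positivity) h5
          _ = c * (n m : ℝ) ^ (-(a / 2)) := by
              rw [mul_assoc, ← Real.rpow_add hn0]
              ring_nf
          _ ≤ c * (n m : ℝ) ^ (-(γ m)) := by
              have := Real.rpow_le_rpow_of_exponent_le h2 (neg_le_neg h4)
              gcongr
          _ = (n m : ℝ) ^ (α - γ m) * (1 - (ε m : ℝ)) := by
              rw [h1, sub_sub_cancel, sub_eq_add_neg, Real.rpow_add hn0]
              field_simp
          _ ≤ k m * (1 - (ε m : ℝ)) :=
              mul_le_mul_of_nonneg_right h3 (by linarith [(ε m).2.2])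
    exact ⟨fun h => PAF.tendsto_errorProb hkey h, fun _ => PAF.tendsto_condErrorProb hkey⟩
  · intro hα hc1 hk
    have hε' : ∀ᶠ m in atTop, 1 - (ε m : ℝ) = c := by
      filter_upwards [hε] with m h1
      rw [h1, hα, Real.rpow_zero]
      ring
    have hkey : Tendsto (fun m => PAF.nonzeroError (C m) (τ m) p (ε m)) atTop (𝓝 0) := by
      refine PAF.tendsto_nonzeroError hn C τ p hp ε hk (β := 1 / 2) hc1
        (hε'.mono fun m h => h.le) (by norm_num) ?_ fun a ha => ?_
      · have hlim := ((tendsto_rpow_atTop (show (0 : ℝ) < 1 / 2 by norm_num)).comp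
          hnR).const_mul_atTop (show 0 < c ^ 2 by positivity)
        filter_upwards [hε', hn1, hlim.eventually_ge_atTop 1] with m h1 h2 h3
        simp only [Function.comp_apply] at h3
        have hn0 : (0 : ℝ) < n m := by linarith
        have e : (n m : ℝ) * (1 - (ε m : ℝ)) ^ 2 =
            c ^ 2 * (n m : ℝ) ^ (1 / 2 : ℝ) * (n m : ℝ) ^ (1 / 2 : ℝ) := by
          rw [h1, mul_assoc, ← Real.rpow_add hn0]
          norm_num [mul_comm]
        rw [e]
        exact le_mul_of_one_le_left (by positivity) h3
      · have hlim := (tendsto_natCast_atTop_atTop (R := ℝ)).comp hk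
        filter_upwards [hε', hn1, (hlim.atTop_mul_const hc).eventually_ge_atTop 1] with m h1 h2 h3
        rw [h1]
        exact (Real.rpow_le_one_of_one_le_of_nonpos h2 (by linarith)).trans h3
    exact ⟨fun h => PAF.tendsto_errorProb hkey h, PAF.tendsto_condErrorProb hkey⟩
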